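/- **Setting.** Consider $\mathbb{Z}^d$ with nearest-neighbour adjacency ($x\sim y$ iff $|x-y|_1=1$). Median dynamics with coin flips on $\mathbb{Z}^d$ is the $[0,1]^{\mathbb{Z}^d}$-valued process $(\eta_t)_{t\ge 0}$ described as follows. The initial opinions $\eta_0(x)$, $x\in\mathbb{Z}^d$, are i.i.d. uniform on $[0,1]$. Each vertex carries an independent rate one Poisson clock and an independent sequence of fair coins, independent of the initial opinions. The opinion of $x$ is constant between rings of the clock at $x$. When this clock rings at time $t$, the $2d$ values $\eta_{t-}(y)$, $y\sim x$, are put in increasing order and $\eta_t(x)$ is set equal to one of the two middle values, chosen by the next coin of $x$ (if $d=0$, the opinion is unchanged). For $\eta\in[0,1]^{\mathbb{Z}^d}$ let $$H(\eta)=\sum_{y\sim 0}|\eta(y)-\eta(0)|,$$ and, for $\varepsilon>0$, let $N_\varepsilon\in\{0,1,2,\dots\}\cup\{\infty\}$ be the total number of updates (flips) of the origin over all times, that is, of rings of its clock, at whose time $t$ one has $|H(\eta_t)-H(\eta_{t-})|\ge\varepsilon$. **Proposition (energy flips on $\mathbb{Z}^d$).** The process is well defined: almost surely, the initial opinions, clocks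 and coins determine exactly one trajectory $(\eta_t)_{t\ge 0}$ that obeys the above rules. For every $\varepsilon>0$, almost surely only finitely many flips of the origin change the local energy $H$ by at least $\varepsilon$ in absolute value, i.e. $N_\varepsilon<\infty$ almost surely. Moreover $N_\varepsilon$ is, up to a null set, a random variable and $$\mathbb{E}[N_\varepsilon]\le \frac{d}{\varepsilon}.$$ -/

import Mathlib

open MeasureTheory ProbabilityTheory
open scoped NNReal ENNReal unitInterval

/-- The nearest-neighbour graph on `ℤ^d`: `x ~ y` when `|x - y|₁ = 1`. -/
def latticeGraph (d : ℕ) : SimpleGraph (Fin d → ℤ) where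
  Adj x y := ∑ i, |x i - y i| = 1
  symm := ⟨fun x y h => by simpa only [abs_sub_comm] using h⟩
  loopless := ⟨fun x h => by simp at h⟩

theorem latticeGraph_neighborSet_finite (d : ℕ) (x : Fin d → ℤ) :
    ((latticeGraph d).neighborSet x).Finite := by
  refine (Set.finite_Icc (fun i => x i - 1) (fun i => x i + 1)).subset ?_
  intro y hy
  have hy' : ∑ i, |x i - y i| = 1 := hy
  have key : ∀ i, |x i - y i| ≤ 1 := fun i =>
    hy' ▸ Finset.single_le_sum (f := fun i => |x i - y i|)
      (fun j _ => abs_nonneg (x j - y j)) (Finset.mem_univ i)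
  constructor <;> intro i <;> have := abs_le.mp (key i) <;> simp only <;> omega

noncomputable instance latticeGraph_locallyFinite (d : ℕ) : (latticeGraph d).LocallyFinite :=
  fun x => (latticeGraph_neighborSet_finite d x).fintype

/-- The randomness attached to one vertex: its initial opinion, the successive waiting times of
its clock, and the coins used at the successive rings. -/
abbrev SiteNoise : Type := I × (ℕ → ℝ) × (ℕ → Bool)

/-- The initial opinion is uniform on `[0,1]`, the waiting times are i.i.d. exponential with
rate `1` (so the rings form a rate one Poisson process), the coins are i.i.d. and fair, and these
three are independent. -/
noncomputable def siteNoiseLaw : Measure SiteNoise :=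
  (volume : Measure I).prod
    ((Measure.infinitePi fun _ : ℕ => expMeasure 1).prod
      (Measure.infinitePi fun _ : ℕ => (PMF.uniformOfFintype Bool).toMeasure))

instance : IsProbabilityMeasure (expMeasure 1) := isProbabilityMeasure_expMeasure one_pos

instance : IsProbabilityMeasure siteNoiseLaw := by
  unfold siteNoiseLaw
  infer_instance

/-- Distinct vertices have independent, identically distributed randomness. -/
noncomputable def noiseLaw (V : Type*) : Measure (V → SiteNoise) :=
  Measure.infinitePi fun _ : V => siteNoiseLaw

section MedianDynamics

variable {V : Type*}

def initialOpinion (ω : V → SiteNoise) (x : V) : I := (ω x).1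

/-- The time of the `n`-th ring (counted from `n = 0`) of the clock at `x`. -/
noncomputable def ringTime (ω : V → SiteNoise) (x : V) (n : ℕ) : ℝ :=
  ∑ k ∈ Finset.range (n + 1), (ω x).2.1 k

def coin (ω : V → SiteNoise) (x : V) (n : ℕ) : Bool := (ω x).2.2 n

/-- The opinions of the neighbours of `x` in increasing order (with repetitions). -/
noncomputable def sortedOpinions (G : SimpleGraph V) [G.LocallyFinite] (ξ : V → I) (x : V) :
    List I :=
  ((G.neighborFinset x).val.map ξ).sort (· ≤ ·)

/-- The middle value of the neighbouring opinions selected by the coin `b`. If the degree `n` of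
`x` is even, the two middle values have the (zero-based) positions `n / 2 - 1` and `n / 2` in
increasing order, and `b` chooses the smaller (`false`) or the larger (`true`) one. If `n` is odd,
both positions below are that of the median. A vertex without neighbours keeps its opinion. -/
noncomputable def medianUpdate (G : SimpleGraph V) [G.LocallyFinite] (ξ : V → I) (x : V)
    (b : Bool) : I :=
  (sortedOpinions G ξ x).getD (if b then G.degree x / 2 else (G.degree x - 1) / 2) (ξ x)

/-- The configuration `η_{t-}` just before time `t`. -/
noncomputable def justBefore (η : ℝ≥0 → V → I) (t : ℝ≥0) : V → I :=
  fun y => Function.leftLim (fun s => η s y) t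

/-- `η` is a trajectory of median dynamics with coin flips on `G`, driven by the initial opinions,
clocks and coins in `ω`. -/
structure IsMedianTrajectory (G : SimpleGraph V) [G.LocallyFinite] (ω : V → SiteNoise)
    (η : ℝ≥0 → V → I) : Prop where
  initial : ∀ x, η 0 x = initialOpinion ω x
  no_ring : ∀ (x : V) (s t : ℝ≥0), s ≤ t →
    (∀ n, ¬ ((s : ℝ) < ringTime ω x n ∧ ringTime ω x n ≤ (t : ℝ))) → η t x = η s x
  ring : ∀ (x : V) (n : ℕ) (t : ℝ≥0), (t : ℝ) = ringTime ω x n →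
    η t x = medianUpdate G (justBefore η t) x (coin ω x n)

/-- The local energy `H(ξ) = ∑_{y ~ x} |ξ(y) - ξ(x)|` at `x`. -/
noncomputable def localEnergy (G : SimpleGraph V) [G.LocallyFinite] (x : V) (ξ : V → I) : ℝ :=
  ∑ y ∈ G.neighborFinset x, |(ξ y : ℝ) - (ξ x : ℝ)|

/-- The (indices of the) updates of `x` at which the local energy at `x` changes by at least `ε`
in absolute value. -/
def energyFlips (G : SimpleGraph V) [G.LocallyFinite] (ω : V → SiteNoise)
    (η : ℝ≥0 → V → I) (x : V) (ε : ℝ) : Set ℕ :=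
  {n | ∃ t : ℝ≥0, (t : ℝ) = ringTime ω x n ∧
    ε ≤ |localEnergy G x (η t) - localEnergy G x (justBefore η t)|}

end MedianDynamics

/-! ### Medians: energy minimisation and measurability -/

section Median

/-! A median of the neighbouring opinions minimises `a ↦ ∑ |η(y) - a|`, so a flip of the origin
never raises its local energy (`energyJump_nonpos`), and a flip counted by `N_ε` burns at least `ε`
of it. It suffices to show that the expected total loss at flips of the origin is at most `d`.

Flips of neighbours may raise that energy, so the loss is controlled by mass transport. Along an
edge `{x, y}`, the quantity `|η(y) - η(x)|` stays in `[0,1]` and changes only at flips of `x` or of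
`y`; hence the gains due to the two endpoints, up to any time, add up to at least `-1`
(`neg_one_le_edgeGain_add`). By translation invariance the expected gain due to `y` on `{0, y}` is
that due to `0` on `{0, -y}`. Summing over the at most `2d` neighbours, twice the expected gain due
to flips of `0` is at least `-2d` (`neg_le_sum_integral_edgeGain`). Fatou's lemma removes the time
horizon.

For the construction, an update depends only on earlier updates at the same vertex or its
neighbours, so everything follows once this dependence is almost surely well founded
(`ae_isGoodNoise`). The times along an infinite backward chain would decrease to a limit `L`. In a
short enough window around `L`, the vertices that ring form a subcritical percolation, whose
clusters are finite; the chain would be trapped among finitely many rings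
(`wellFounded_of_finite_clusters`). Given well-foundedness, truncated recursions (`approxTable`) are
eventually constant, which yields existence, uniqueness and measurability. -/

theorem sum_abs_sub_median_le {n : ℕ} {l : Fin n → ℝ} (hl : Monotone l) (i : Fin n)
    (h₁ : (n - 1) / 2 ≤ (i : ℕ)) (h₂ : (i : ℕ) ≤ n / 2) (a : ℝ) :
    ∑ j, |l j - l i| ≤ ∑ j, |l j - a| := by
  have hrev : ∀ c : ℝ, ∑ j, |l (Fin.rev j) - c| = ∑ j, |l j - c| := fun c =>
    Equiv.sum_comp Fin.revPerm fun j => |l j - c|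
  -- Pair each position with its mirror image: a middle value lies between `l j` and `l (rev j)`, so
  -- its two distances add up to the gap between them, the least possible.
  have key : ∀ j, |l j - l i| + |l (Fin.rev j) - l i| ≤ |l j - a| + |l (Fin.rev j) - a| := by
    intro j
    have hj := j.isLt
    rcases le_total (j : ℕ) (Fin.rev j : ℕ) with h | h <;> rw [Fin.val_rev] at h
    · have e₁ : l j ≤ l i := hl (Fin.le_def.2 (by omega))
      have e₂ : l i ≤ l (Fin.rev j) := hl (Fin.le_def.2 (by rw [Fin.val_rev]; omega))
      rw [abs_of_nonpos (sub_nonpos.2 e₁), abs_of_nonneg (sub_nonneg.2 e₂)]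
      linarith [neg_abs_le (l j - a), le_abs_self (l (Fin.rev j) - a)]
    · have e₁ : l i ≤ l j := hl (Fin.le_def.2 (by omega))
      have e₂ : l (Fin.rev j) ≤ l i := hl (Fin.le_def.2 (by rw [Fin.val_rev]; omega))
      rw [abs_of_nonneg (sub_nonneg.2 e₁), abs_of_nonpos (sub_nonpos.2 e₂)]
      linarith [neg_abs_le (l (Fin.rev j) - a), le_abs_self (l j - a)]
  have := Finset.sum_le_sum fun j (_ : j ∈ Finset.univ) => key j
  rw [Finset.sum_add_distrib, Finset.sum_add_distrib, hrev, hrev] at this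
  linarith

variable {V : Type*} (G : SimpleGraph V) [G.LocallyFinite]

theorem length_sortedOpinions (ξ : V → I) (x : V) : (sortedOpinions G ξ x).length = G.degree x := by
  simp [sortedOpinions]

theorem sum_neighbor_eq_sum_sortedOpinions (ξ : V → I) (x : V) (f : I → ℝ) :
    ∑ y ∈ G.neighborFinset x, f (ξ y) = ∑ j, f ((sortedOpinions G ξ x).get j) := by
  have h₁ : ∑ y ∈ G.neighborFinset x, f (ξ y)
      = (((G.neighborFinset x).val.map ξ).map f).sum := by
    rw [Multiset.map_map]; rfl
  rw [h₁, ← Multiset.sort_eq ((G.neighborFinset x).val.map ξ) (· ≤ ·), Multiset.map_coe,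
    Multiset.sum_coe, ← List.ofFn_get ((Multiset.sort _ _).map f)]
  simp only [sortedOpinions, List.sum_ofFn]
  exact (Fintype.sum_equiv (finCongr (by simp)) _ _ (by simp)).symm

theorem medianUpdate_minimizes (ξ : V → I) (x : V) (b : Bool) (a : ℝ) :
    ∑ y ∈ G.neighborFinset x, |(ξ y : ℝ) - (medianUpdate G ξ x b : ℝ)|
      ≤ ∑ y ∈ G.neighborFinset x, |(ξ y : ℝ) - a| := by
  have hlen := length_sortedOpinions G ξ x
  rcases Nat.eq_zero_or_pos (G.degree x) with h0 | hpos
  · rw [← G.card_neighborFinset_eq_degree, Finset.card_eq_zero] at h0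
    simp [h0]
  set k := if b then G.degree x / 2 else (G.degree x - 1) / 2 with hk
  have hkb : (G.degree x - 1) / 2 ≤ k ∧ k ≤ G.degree x / 2 := by
    rw [hk]; split_ifs <;> omega
  have hlt : k < (sortedOpinions G ξ x).length := by omega
  have hm : medianUpdate G ξ x b = (sortedOpinions G ξ x).get ⟨k, hlt⟩ := by
    rw [medianUpdate, ← hk, List.getD_eq_getElem _ _ hlt, List.get_eq_getElem]
  rw [hm, sum_neighbor_eq_sum_sortedOpinions G ξ x
      (fun z => |(z : ℝ) - ((sortedOpinions G ξ x).get ⟨k, hlt⟩ : ℝ)|),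
    sum_neighbor_eq_sum_sortedOpinions G ξ x (fun z => |(z : ℝ) - a|)]
  refine sum_abs_sub_median_le (l := fun j => ((sortedOpinions G ξ x).get j : ℝ)) ?_ ⟨k, hlt⟩
    (by simpa [hlen] using hkb.1) (by simpa [hlen] using hkb.2) a
  intro i j hij
  exact Subtype.coe_le_coe.2
    ((Multiset.pairwise_sort ((G.neighborFinset x).val.map ξ) (· ≤ ·)).rel_get_of_le hij)

variable {G} in
theorem medianUpdate_congr {ξ ξ' : V → I} {x : V} (b : Bool) (hx : ξ x = ξ' x)
    (h : ∀ y, G.Adj x y → ξ y = ξ' y) : medianUpdate G ξ x b = medianUpdate G ξ' x b := by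
  have : sortedOpinions G ξ x = sortedOpinions G ξ' x := by
    unfold sortedOpinions
    rw [Multiset.map_congr rfl fun y hy => h y ((G.mem_neighborFinset x y).1 hy)]
  rw [medianUpdate, medianUpdate, this, hx]

/-- In a sorted list the entries at most `a` form an initial segment. This reduces measurability of
order statistics to that of a count. -/
theorem List.getD_le_iff_lt_countP {l : List I} (hl : l.Pairwise (· ≤ ·)) {i : ℕ}
    (hi : i < l.length) (c a : I) : l.getD i c ≤ a ↔ i < l.countP (· ≤ a) := by
  induction l generalizing i with
  | nil => simp at hi
  | cons b l ih =>
    rw [List.pairwise_cons] at hl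
    by_cases hb : b ≤ a
    · rw [List.countP_cons_of_pos (by simpa using hb)]
      cases i with
      | zero => simp [hb]
      | succ i => simpa using ih hl.2 (by simpa using hi)
    · have h0 : (b :: l).countP (· ≤ a) = 0 := by
        rw [List.countP_eq_zero]
        intro z hz
        rcases List.mem_cons.1 hz with rfl | hz
        · simpa using hb
        · simpa using (not_le.1 hb).trans_le (hl.1 z hz)
      rw [h0]
      have hmem : (b :: l).getD i c ∈ b :: l := by
        rw [List.getD_eq_getElem _ _ hi]; exact List.getElem_mem hi
      have : ¬ (b :: l).getD i c ≤ a := by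
        have := (List.countP_eq_zero.1 h0) _ hmem
        simpa using this
      simp only [this, Nat.not_lt_zero]

theorem measurable_medianUpdate {Ω : Type*} [MeasurableSpace Ω] {ξ : Ω → V → I} {b : Ω → Bool}
    (hξ : ∀ y, Measurable fun ω => ξ ω y) (hb : Measurable b) (x : V) :
    Measurable fun ω => medianUpdate G (ξ ω) x (b ω) := by
  have hstat : ∀ i, Measurable fun ω => (sortedOpinions G (ξ ω) x).getD i (ξ ω x) := by
    intro i
    rcases lt_or_ge i (G.degree x) with hi | hi
    · refine measurable_of_Iic fun a => ?_
      have : (fun ω => (sortedOpinions G (ξ ω) x).getD i (ξ ω x)) ⁻¹' Set.Iic a =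
          {ω | i < ∑ y ∈ G.neighborFinset x, if ξ ω y ≤ a then 1 else 0} := by
        ext ω
        have hsort : (sortedOpinions G (ξ ω) x).Pairwise (· ≤ ·) := Multiset.pairwise_sort _ _
        rw [Set.mem_preimage, Set.mem_Iic, Set.mem_ofPred_eq, List.getD_le_iff_lt_countP
          hsort (by rwa [length_sortedOpinions]), ← Multiset.coe_countP,
          sortedOpinions, Multiset.sort_eq, Multiset.countP_map, ← Finset.card_filter]
        rfl
      rw [this]
      refine measurableSet_lt measurable_const (Finset.measurable_sum _ fun y _ => ?_)
      exact Measurable.ite (measurableSet_le (hξ y) measurable_const) measurable_const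
        measurable_const
    -- Out of range, `getD` returns its default; for the indices used here this is the case of
    -- degree `0`.
    · have : (fun ω => (sortedOpinions G (ξ ω) x).getD i (ξ ω x)) = fun ω => ξ ω x := by
        funext ω
        exact List.getD_eq_default _ _ (by rwa [length_sortedOpinions])
      rw [this]
      exact hξ x
  have : (fun ω => medianUpdate G (ξ ω) x (b ω)) = fun ω =>
      if b ω = true then (sortedOpinions G (ξ ω) x).getD (G.degree x / 2) (ξ ω x)
        else (sortedOpinions G (ξ ω) x).getD ((G.degree x - 1) / 2) (ξ ω x) := by
    funext ω
    cases h : b ω <;> simp [medianUpdate]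
  rw [this]
  exact Measurable.ite (hb (measurableSet_singleton true)) (hstat _) (hstat _)

end Median

/-! ### Counting the rings of a clock; two interleaved clocks -/

section Counting

/-- The number of terms of the increasing sequence `s` that are smaller than `t`. -/
noncomputable def countBefore (s : ℕ → ℝ) (t : ℝ) : ℕ := sInf {m | t ≤ s m}

/-- The number of terms of the increasing sequence `s` that are at most `t`. -/
noncomputable def countUpTo (s : ℕ → ℝ) (t : ℝ) : ℕ := sInf {m | t < s m}

variable {s : ℕ → ℝ} (hs : StrictMono s) (hs' : Filter.Tendsto s Filter.atTop Filter.atTop)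
include hs hs'

theorem lt_countBefore {t : ℝ} {m : ℕ} : m < countBefore s t ↔ s m < t := by
  have hne : {m | t ≤ s m}.Nonempty := (hs'.eventually_ge_atTop t).exists
  constructor
  · intro h
    simpa using Nat.notMem_of_lt_sInf h
  · intro h
    by_contra hc
    have h₁ : t ≤ s (countBefore s t) := Nat.sInf_mem hne
    exact absurd (h₁.trans (hs.monotone (not_lt.1 hc))) (not_le.2 h)

theorem lt_countUpTo {t : ℝ} {m : ℕ} : m < countUpTo s t ↔ s m ≤ t := by
  have hne : {m | t < s m}.Nonempty := (hs'.eventually_gt_atTop t).exists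
  constructor
  · intro h
    simpa using Nat.notMem_of_lt_sInf h
  · intro h
    by_contra hc
    have h₁ : t < s (countUpTo s t) := Nat.sInf_mem hne
    exact absurd (h₁.trans_le (hs.monotone (not_lt.1 hc))) (not_lt.2 h)

theorem countBefore_self (n : ℕ) : countBefore s (s n) = n :=
  eq_of_forall_lt_iff fun _ => by rw [lt_countBefore hs hs', hs.lt_iff_lt]

theorem countUpTo_self (n : ℕ) : countUpTo s (s n) = n + 1 :=
  eq_of_forall_lt_iff fun _ => by rw [lt_countUpTo hs hs', hs.le_iff_le, Nat.lt_succ_iff]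

theorem countUpTo_eq_countBefore {t : ℝ} (h : ∀ n, s n ≠ t) : countUpTo s t = countBefore s t :=
  eq_of_forall_lt_iff fun m => by
    rw [lt_countUpTo hs hs', lt_countBefore hs hs', (h m).le_iff_lt]

theorem countUpTo_eq_of_gap {t u : ℝ} (htu : t ≤ u) (h : ∀ n, ¬ (t < s n ∧ s n ≤ u)) :
    countUpTo s u = countUpTo s t :=
  eq_of_forall_lt_iff fun m => by
    rw [lt_countUpTo hs hs', lt_countUpTo hs hs']
    exact ⟨fun hm => not_lt.1 fun h' => h m ⟨h', hm⟩, fun hm => hm.trans htu⟩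

/-- Telescoping along the lattice path that records the terms of two increasing sequences. -/
theorem telescope_two_clocks {r : ℕ → ℝ} (hr : StrictMono r)
    (hr' : Filter.Tendsto r Filter.atTop Filter.atTop) (hsr : ∀ m n, s m ≠ r n) (φ : ℕ → ℕ → ℝ)
    (N M : ℕ) (hN : ∀ n < N, s n < r M) (hM : ∀ m < M, r m < s N) :
    φ N M - φ 0 0 =
      ∑ n ∈ Finset.range N, (φ (n + 1) (countBefore r (s n)) - φ n (countBefore r (s n))) +
      ∑ m ∈ Finset.range M, (φ (countBefore s (r m)) (m + 1) - φ (countBefore s (r m)) m) := by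
  induction hK : N + M generalizing N M with
  | zero =>
    obtain ⟨rfl, rfl⟩ : N = 0 ∧ M = 0 := by omega
    simp
  | succ K ih =>
    -- Remove the latest of the first `N` terms of `s` and the first `M` terms of `r`. By `hN` and
    -- `hM`, counting the other sequence at that term gives the full other coordinate.
    by_cases hcase : ∃ n, N = n + 1 ∧ ∀ m < M, r m < s n
    · obtain ⟨n, rfl, hn⟩ := hcase
      have hc : countBefore r (s n) = M := eq_of_forall_lt_iff fun m => by
        rw [lt_countBefore hr hr']
        refine ⟨fun h => ?_, hn m⟩
        exact hr.lt_iff_lt.1 (h.trans (hN n n.lt_succ_self))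
      have := ih n M (fun k hk => hN k (hk.trans n.lt_succ_self)) hn (by omega)
      rw [Finset.sum_range_succ, hc]
      linarith
    · have hM0 : ∃ m, M = m + 1 ∧ ∀ n < N, s n < r m := by
        push Not at hcase
        cases M with
        | zero =>
          obtain ⟨n, rfl⟩ : ∃ n, N = n + 1 := ⟨N - 1, by omega⟩
          obtain ⟨m, hm, -⟩ := hcase n rfl
          omega
        | succ m =>
          refine ⟨m, rfl, fun n hn => ?_⟩
          obtain ⟨k, rfl⟩ : ∃ k, N = k + 1 := ⟨N - 1, by omega⟩
          obtain ⟨j, hj, hjk⟩ := hcase k rfl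
          exact lt_of_le_of_ne (((hs.monotone (Nat.lt_succ_iff.1 hn)).trans hjk).trans
            (hr.monotone (Nat.lt_succ_iff.1 hj))) (hsr n m)
      obtain ⟨m, rfl, hm⟩ := hM0
      have hc : countBefore s (r m) = N := eq_of_forall_lt_iff fun k => by
        rw [lt_countBefore hs hs']
        refine ⟨fun h => ?_, hm k⟩
        exact hs.lt_iff_lt.1 (h.trans (hM m m.lt_succ_self))
      have := ih N m hm (fun k hk => hM k (hk.trans m.lt_succ_self)) (by omega)
      rw [Finset.sum_range_succ _ m, hc]
      linarith

end Counting

/-! ### Existence and uniqueness of the trajectory for good noise -/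

section Trajectories

open Filter Topology

variable {V : Type*} (G : SimpleGraph V) [G.LocallyFinite]

/-- The events of a realisation of the noise on which the dynamics are well defined. -/
structure IsGoodNoise (G : SimpleGraph V) (ω : V → SiteNoise) : Prop where
  pos : ∀ x, 0 < ringTime ω x 0
  strictMono : ∀ x, StrictMono (ringTime ω x)
  tendsto : ∀ x, Tendsto (ringTime ω x) atTop atTop
  ne : ∀ x y, x ≠ y → ∀ m n, ringTime ω x m ≠ ringTime ω y n
  -- The pair `(x, n)` stands for the `n`-th update of `x`; the relation contains every dependence
  -- of an update on earlier ones.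
  wf : WellFounded fun p q : V × ℕ =>
    (p.1 = q.1 ∨ G.Adj q.1 p.1) ∧ ringTime ω p.1 p.2 < ringTime ω q.1 q.2

/-- `w x n` is the opinion of `x` after its first `n` updates. -/
structure IsUpdateTable (ω : V → SiteNoise) (w : V → ℕ → I) : Prop where
  zero : ∀ x, w x 0 = initialOpinion ω x
  succ : ∀ x n, w x (n + 1) = medianUpdate G
    (fun y => w y (countBefore (ringTime ω y) (ringTime ω x n))) x (coin ω x n)

/-- Approximations of the update table, in which the opinions used are traced back through
at most `k` generations. -/
noncomputable def approxTable (ω : V → SiteNoise) : ℕ → V → ℕ → I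
  | 0, x, _ => initialOpinion ω x
  | _ + 1, x, 0 => initialOpinion ω x
  | k + 1, x, n + 1 => medianUpdate G
      (fun y => approxTable ω k y (countBefore (ringTime ω y) (ringTime ω x n))) x (coin ω x n)

theorem approxTable_zero (ω : V → SiteNoise) (k : ℕ) (x : V) :
    approxTable G ω k x 0 = initialOpinion ω x := by
  cases k <;> rfl

variable {G} {ω : V → SiteNoise}

/-- An update reads finitely many opinions, so eventual constancy passes from its inputs to its
output. The input at `x` itself matters as the default in `medianUpdate`. -/
theorem approxTable_succ_eventually {x : V} {n : ℕ} {v : V → I}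
    (h : ∀ y, y = x ∨ G.Adj x y →
      ∀ᶠ k in atTop, approxTable G ω k y (countBefore (ringTime ω y) (ringTime ω x n)) = v y) :
    ∀ᶠ k in atTop, approxTable G ω k x (n + 1) = medianUpdate G v x (coin ω x n) := by
  have hnb : ∀ᶠ k in atTop, ∀ y ∈ G.neighborFinset x,
      approxTable G ω k y (countBefore (ringTime ω y) (ringTime ω x n)) = v y :=
    (eventually_all_finset _).2 fun y hy => h y (Or.inr ((G.mem_neighborFinset x y).1 hy))
  obtain ⟨K, hK⟩ := eventually_atTop.1 ((h x (Or.inl rfl)).and hnb)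
  filter_upwards [eventually_ge_atTop (K + 1)] with k hk
  obtain ⟨k, rfl⟩ : ∃ j, k = j + 1 := ⟨k - 1, by omega⟩
  have := hK k (by omega)
  exact medianUpdate_congr _ this.1 fun y hy => this.2 y ((G.mem_neighborFinset x y).2 hy)

namespace IsGoodNoise

variable (hω : IsGoodNoise G ω)
include hω

omit [G.LocallyFinite] in
theorem induction_updates {p : V → ℕ → Prop} (h0 : ∀ x, p x 0)
    (hs : ∀ x n, (∀ y, y = x ∨ G.Adj x y →
      p y (countBefore (ringTime ω y) (ringTime ω x n))) → p x (n + 1)) (x : V) (n : ℕ) :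
    p x n := by
  -- Index shift: update `n` produces state `n + 1`, while state `0` needs no update.
  have key : ∀ q : V × ℕ, p q.1 (q.2 + 1) := fun q => hω.wf.induction q fun q ih =>
    hs q.1 q.2 fun y hy => by
      rcases hc : countBefore (ringTime ω y) (ringTime ω q.1 q.2) with _ | j
      · exact h0 y
      · exact ih (y, j) ⟨hy, (lt_countBefore (hω.strictMono y) (hω.tendsto y)).1 (by omega)⟩
  cases n with
  | zero => exact h0 x
  | succ n => exact key (x, n)

theorem approxTable_eventually_eq {w : V → ℕ → I} (hw : IsUpdateTable G ω w) (x : V) (n : ℕ) :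
    ∀ᶠ k in atTop, approxTable G ω k x n = w x n := by
  refine hω.induction_updates (p := fun x n => ∀ᶠ k in atTop, approxTable G ω k x n = w x n)
    (fun x => ?_) (fun x n ih => ?_) x n
  · simp [approxTable_zero, hw.zero]
  · rw [hw.succ]
    exact approxTable_succ_eventually ih

theorem exists_isUpdateTable : ∃ w, IsUpdateTable G ω w := by
  have h : ∀ x n, ∃ v, ∀ᶠ k in atTop, approxTable G ω k x n = v := by
    refine hω.induction_updates (fun x => ⟨initialOpinion ω x, ?_⟩) fun x n ih => ?_
    · simp [approxTable_zero]
    · choose! v hv using ih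
      exact ⟨_, approxTable_succ_eventually hv⟩
  choose w hw using h
  refine ⟨w, fun x => ?_, fun x n => ?_⟩
  · obtain ⟨k, hk⟩ := (hw x 0).exists
    rw [← hk, approxTable_zero]
  · obtain ⟨k, hk, hk'⟩ := ((hw x (n + 1)).and
      (approxTable_succ_eventually (x := x) (n := n) fun y _ => hw y _)).exists
    rw [← hk, hk']

theorem isUpdateTable_unique {w w' : V → ℕ → I} (hw : IsUpdateTable G ω w)
    (hw' : IsUpdateTable G ω w') : w = w' := by
  funext x n
  obtain ⟨k, hk, hk'⟩ := ((hω.approxTable_eventually_eq hw x n).and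
    (hω.approxTable_eventually_eq hw' x n)).exists
  rw [← hk, hk']

omit [G.LocallyFinite] in
theorem ringTime_pos (x : V) (n : ℕ) : 0 < ringTime ω x n :=
  (hω.pos x).trans_le ((hω.strictMono x).monotone n.zero_le)

omit [G.LocallyFinite] in
theorem countUpTo_zero (x : V) : countUpTo (ringTime ω x) 0 = 0 := by
  by_contra h
  exact absurd ((lt_countUpTo (hω.strictMono x) (hω.tendsto x)).1 (Nat.pos_of_ne_zero h))
    (not_le.2 (hω.pos x))

omit [G.LocallyFinite] in
-- Only finitely many rings precede `t`, and all of them have occurred by any time close enough to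
-- `t` from the left. Positivity of `t` makes the left neighbourhood nontrivial.
theorem justBefore_eq (w : V → ℕ → I) {t : ℝ≥0} (ht : 0 < t) :
    justBefore (fun (t : ℝ≥0) x => w x (countUpTo (ringTime ω x) t)) t =
      fun x => w x (countBefore (ringTime ω x) t) := by
  funext x
  have hs := hω.strictMono x
  have hs' := hω.tendsto x
  have : (𝓝[<] t).NeBot := nhdsLT_neBot_of_exists_lt ⟨0, ht⟩
  have hev : ∀ᶠ u : ℝ≥0 in 𝓝[<] t,
      w x (countUpTo (ringTime ω x) u) = w x (countBefore (ringTime ω x) t) := by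
    have h₁ : ∀ᶠ u : ℝ≥0 in 𝓝[<] t,
        ∀ m ∈ Finset.range (countBefore (ringTime ω x) t), ringTime ω x m ≤ u := by
      refine (eventually_all_finset _).2 fun m hm => nhdsWithin_le_nhds ?_
      have hlt := (lt_countBefore hs hs').1 (Finset.mem_range.1 hm)
      filter_upwards [(NNReal.continuous_coe.tendsto t).eventually (lt_mem_nhds hlt)] with u hu
      exact hu.le
    filter_upwards [h₁, self_mem_nhdsWithin] with u hu hut
    congr 1
    refine eq_of_forall_lt_iff fun m => ?_
    rw [lt_countUpTo hs hs']
    exact ⟨fun h => (lt_countBefore hs hs').2 (h.trans_lt (NNReal.coe_lt_coe.2 hut)),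
      fun h => hu m (Finset.mem_range.2 h)⟩
  exact leftLim_eq_of_tendsto (tendsto_const_nhds.congr' (hev.mono fun _ h => h.symm))

theorem isMedianTrajectory_iff (η : ℝ≥0 → V → I) : IsMedianTrajectory G ω η ↔
    ∃ w, IsUpdateTable G ω w ∧ η = fun (t : ℝ≥0) x => w x (countUpTo (ringTime ω x) t) := by
  constructor
  · intro h
    -- The table reads off the opinion at the ring itself; `no_ring` then determines it up to the
    -- next ring.
    let w : V → ℕ → I := fun x n =>
      match n with
      | 0 => initialOpinion ω x
      | n + 1 => η (ringTime ω x n).toNNReal x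
    have hη : η = fun (t : ℝ≥0) x => w x (countUpTo (ringTime ω x) t) := by
      funext t x
      have hs := hω.strictMono x
      have hs' := hω.tendsto x
      rcases hc : countUpTo (ringTime ω x) t with _ | m
      · rw [h.no_ring x 0 t zero_le, h.initial x]
        intro n hn
        have := (lt_countUpTo hs hs').2 hn.2
        omega
      · have hcoe := Real.coe_toNNReal _ (hω.ringTime_pos x m).le
        have hm : ringTime ω x m ≤ t := (lt_countUpTo hs hs').1 (by omega)
        refine h.no_ring x _ t (by rwa [← NNReal.coe_le_coe, hcoe]) ?_
        intro n hn
        rw [hcoe] at hn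
        have h₁ := hs.lt_iff_lt.1 hn.1
        have h₂ := (lt_countUpTo hs hs').2 hn.2
        omega
    refine ⟨w, ⟨fun x => rfl, fun x n => ?_⟩, hη⟩
    have hpos := hω.ringTime_pos x n
    have hcoe := Real.coe_toNNReal _ hpos.le
    have hr := h.ring x n _ hcoe
    have hj := hω.justBefore_eq w (Real.toNNReal_pos.2 hpos)
    rw [← hη, hcoe] at hj
    rw [hj] at hr
    exact hr
  · rintro ⟨w, hw, rfl⟩
    refine ⟨fun x => ?_, fun x s t hst hgap => ?_, fun x n t ht => ?_⟩
    · simp [hω.countUpTo_zero, hw.zero]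
    · simp only [countUpTo_eq_of_gap (hω.strictMono x) (hω.tendsto x)
        (NNReal.coe_le_coe.2 hst) hgap]
    · have hpos : 0 < t := by
        rw [← NNReal.coe_pos, ht]; exact hω.ringTime_pos x n
      rw [hω.justBefore_eq w hpos]
      simp only [ht, countUpTo_self (hω.strictMono x) (hω.tendsto x), hw.succ]

theorem existsUnique_trajectory : ∃! η : ℝ≥0 → V → I, IsMedianTrajectory G ω η := by
  obtain ⟨w, hw⟩ := hω.exists_isUpdateTable
  refine ⟨_, (hω.isMedianTrajectory_iff _).2 ⟨w, hw, rfl⟩, ?_⟩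
  intro η hη
  obtain ⟨w', hw', rfl⟩ := (hω.isMedianTrajectory_iff _).1 hη
  rw [hω.isUpdateTable_unique hw' hw]

end IsGoodNoise

end Trajectories

/-! ### Ring times of a single Poisson clock -/

section Clocks

open Filter Topology

theorem expMeasure_one_le_volume : expMeasure 1 ≤ volume := by
  have h : (exponentialPDF 1 : ℝ → ℝ≥0∞) ≤ 1 := fun x => by
    rw [exponentialPDF_eq, Pi.one_apply, ENNReal.ofReal_le_one]
    split_ifs with hx
    · simpa using hx
    · exact zero_le_one
  calc expMeasure 1 = volume.withDensity (exponentialPDF 1) := rfl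
    _ ≤ volume.withDensity 1 := withDensity_mono (ae_of_all _ h)
    _ = volume := withDensity_one

theorem ae_expMeasure_one_pos : ∀ᵐ x ∂expMeasure 1, 0 < x := by
  have h : expMeasure 1 (Set.Iio 0) = 0 := by
    change volume.withDensity (exponentialPDF 1) (Set.Iio 0) = 0
    rw [withDensity_apply _ measurableSet_Iio]
    exact lintegral_exponentialPDF_of_nonpos le_rfl
  have h0 : expMeasure 1 {0} = 0 :=
    le_antisymm ((expMeasure_one_le_volume _).trans (by simp)) zero_le
  have : expMeasure 1 (Set.Iic 0) = 0 := by
    rw [← Set.Iio_union_right]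
    exact measure_union_null h h0
  rw [ae_iff]
  convert this using 2
  ext x
  simp

theorem integrable_exp_neg_expMeasure : Integrable (fun x => Real.exp (-1 * x)) (expMeasure 1) := by
  refine Integrable.of_bound (by fun_prop) 1 ?_
  filter_upwards [ae_expMeasure_one_pos] with x hx
  rw [Real.norm_eq_abs, Real.abs_exp, Real.exp_le_one_iff]
  linarith

theorem mgf_expMeasure_neg_one_lt_one : mgf id (expMeasure 1) (-1) < 1 := by
  have hint := integrable_exp_neg_expMeasure
  have h : 0 < ∫ x, (1 - Real.exp (-1 * x)) ∂expMeasure 1 := by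
    rw [integral_pos_iff_support_of_nonneg_ae (f := fun x => 1 - Real.exp (-1 * x)) _
      ((integrable_const 1).sub hint)]
    · have : Set.univ ≤ᵐ[expMeasure 1] Function.support fun x => 1 - Real.exp (-1 * x) := by
        filter_upwards [ae_expMeasure_one_pos] with x hx _
        have : Real.exp (-1 * x) < 1 := by simpa using hx
        exact (sub_pos.2 this).ne'
      exact lt_of_lt_of_le (by simp) (measure_mono_ae this)
    · filter_upwards [ae_expMeasure_one_pos] with x hx
      have : Real.exp (-1 * x) ≤ 1 := Real.exp_le_one_iff.2 (by linarith)
      simpa using this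
  have hsub : ∫ x, (1 - Real.exp (-1 * x)) ∂expMeasure 1 = 1 - mgf id (expMeasure 1) (-1) :=
    (integral_sub (integrable_const 1) hint).trans (by simp [mgf])
  rw [hsub] at h
  exact sub_pos.1 h

/-- Lebesgue measure is translation invariant, so a density bound by `1` survives the addition of an
independent variable. -/
theorem map_add_prod_le_volume {ν ρ : Measure ℝ} [SFinite ν] [IsProbabilityMeasure ρ]
    (hν : ν ≤ volume) : (ν.prod ρ).map (fun p => p.1 + p.2) ≤ volume := by
  refine Measure.le_iff.2 fun A hA => ?_
  rw [Measure.map_apply (by fun_prop) hA, Measure.prod_apply_symm (measurable_add hA)]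
  calc ∫⁻ b, ν ((fun a => (a, b)) ⁻¹' ((fun p : ℝ × ℝ => p.1 + p.2) ⁻¹' A)) ∂ρ
      ≤ ∫⁻ _, volume A ∂ρ := by
        refine lintegral_mono fun b => (hν _).trans_eq ?_
        exact measure_preimage_add_right volume b A
    _ = volume A := by simp

/-- The `n`-th ring time of a single clock. -/
noncomputable def siteRing (z : SiteNoise) (n : ℕ) : ℝ := ∑ k ∈ Finset.range (n + 1), z.2.1 k

theorem measurable_siteRing (n : ℕ) : Measurable fun z => siteRing z n :=
  Finset.measurable_sum _ fun k _ => by fun_prop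

theorem measurePreserving_waitingTimes : MeasurePreserving (fun z : SiteNoise => z.2.1)
    siteNoiseLaw (Measure.infinitePi fun _ : ℕ => expMeasure 1) :=
  measurePreserving_fst.comp measurePreserving_snd

theorem iIndepFun_waitingTimes :
    iIndepFun (fun k (z : SiteNoise) => z.2.1 k) siteNoiseLaw := by
  rw [iIndepFun_iff_map_fun_eq_infinitePi_map (by fun_prop)]
  rw [measurePreserving_waitingTimes.map_eq]
  congr 1
  funext k
  exact ((measurePreserving_eval_infinitePi (fun _ : ℕ => expMeasure 1) k).comp
    measurePreserving_waitingTimes).map_eq.symm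

theorem measurePreserving_waitingTime (k : ℕ) :
    MeasurePreserving (fun z : SiteNoise => z.2.1 k) siteNoiseLaw (expMeasure 1) :=
  (measurePreserving_eval_infinitePi (fun _ : ℕ => expMeasure 1) k).comp
    measurePreserving_waitingTimes

theorem map_siteRing_le_volume (n : ℕ) :
    siteNoiseLaw.map (fun z => siteRing z n) ≤ volume := by
  have hm : Measurable fun z : SiteNoise => ∑ k ∈ Finset.range n, z.2.1 k :=
    Finset.measurable_sum _ fun k _ => by fun_prop
  have hind : IndepFun (fun z : SiteNoise => z.2.1 n)
      (fun z : SiteNoise => ∑ k ∈ Finset.range n, z.2.1 k) siteNoiseLaw := by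
    have := iIndepFun_waitingTimes.indepFun_finsetSum_of_notMem (s := Finset.range n) (i := n)
      (fun k => by fun_prop) (by simp)
    convert this.symm using 1
    funext z
    simp
  have h : (fun z => siteRing z n) = (fun p : ℝ × ℝ => p.1 + p.2) ∘
      fun z : SiteNoise => (z.2.1 n, ∑ k ∈ Finset.range n, z.2.1 k) := by
    funext z
    simp [siteRing, Finset.sum_range_succ, add_comm]
  rw [h, ← Measure.map_map (by fun_prop) (by fun_prop),
    hind.map_prod_eq_prod_map_map (by fun_prop) hm.aemeasurable,
    (measurePreserving_waitingTime n).map_eq]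
  have := Measure.isProbabilityMeasure_map (μ := siteNoiseLaw) hm.aemeasurable
  exact map_add_prod_le_volume expMeasure_one_le_volume

/-- Chernoff bound with parameter `-1`; the moment generating function there is less than `1`, so
the decay in `n` is geometric. -/
theorem siteNoiseLaw_siteRing_le (n : ℕ) (t : ℝ) : siteNoiseLaw {z | siteRing z n ≤ t}
    ≤ ENNReal.ofReal (Real.exp t * mgf id (expMeasure 1) (-1) ^ (n + 1)) := by
  have hmgf : ∀ k, mgf (fun z : SiteNoise => z.2.1 k) siteNoiseLaw (-1)
      = mgf id (expMeasure 1) (-1) := fun k => by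
    rw [← (measurePreserving_waitingTime k).map_eq, mgf_id_map (by fun_prop)]
  have hpos : ∀ᵐ z ∂siteNoiseLaw, ∀ k, 0 < z.2.1 k := ae_all_iff.2 fun k =>
    (measurePreserving_waitingTime k).quasiMeasurePreserving.ae ae_expMeasure_one_pos
  have hint : Integrable (fun z => Real.exp (-1 * siteRing z n)) siteNoiseLaw := by
    refine Integrable.of_bound
      ((measurable_siteRing n).const_mul (-1)).exp.aestronglyMeasurable 1 ?_
    filter_upwards [hpos] with z hz
    rw [Real.norm_eq_abs, Real.abs_exp, Real.exp_le_one_iff]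
    have : 0 ≤ siteRing z n := Finset.sum_nonneg fun k _ => (hz k).le
    linarith
  have h := measure_le_le_exp_mul_mgf (μ := siteNoiseLaw) (X := fun z => siteRing z n) t
    (by norm_num) hint
  have hsum : (fun z => siteRing z n) =
      ∑ k ∈ Finset.range (n + 1), fun z : SiteNoise => z.2.1 k := by
    funext z; simp [siteRing]
  rw [hsum, iIndepFun_waitingTimes.mgf_sum (fun k => by fun_prop),
    Finset.prod_congr rfl fun k _ => hmgf k, Finset.prod_const, Finset.card_range] at h
  rw [← ENNReal.ofReal_toReal (measure_ne_top siteNoiseLaw {z | siteRing z n ≤ t})]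
  exact ENNReal.ofReal_le_ofReal (by simpa [Measure.real] using h)

theorem tsum_siteRing_le_ne_top (t : ℝ) :
    ∑' n, siteNoiseLaw {z | siteRing z n ≤ t} ≠ ∞ := by
  refine ne_top_of_le_ne_top ?_ (ENNReal.tsum_le_tsum fun n => siteNoiseLaw_siteRing_le n t)
  have h0 : 0 ≤ mgf id (expMeasure 1) (-1) := mgf_nonneg
  have hs : Summable fun n : ℕ => Real.exp t * mgf id (expMeasure 1) (-1) ^ (n + 1) :=
    ((summable_nat_add_iff 1).2
      (summable_geometric_of_lt_one h0 mgf_expMeasure_neg_one_lt_one)).mul_left _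
  rw [← ENNReal.ofReal_tsum_of_nonneg (fun n => by positivity) hs]
  exact ENNReal.ofReal_ne_top

theorem ae_siteRing : ∀ᵐ z ∂siteNoiseLaw, 0 < siteRing z 0 ∧ StrictMono (siteRing z) ∧
    Tendsto (siteRing z) atTop atTop := by
  have hpos : ∀ᵐ z ∂siteNoiseLaw, ∀ k, 0 < z.2.1 k := ae_all_iff.2 fun k =>
    (measurePreserving_waitingTime k).quasiMeasurePreserving.ae ae_expMeasure_one_pos
  have hbc : ∀ᵐ z ∂siteNoiseLaw, ∀ T : ℕ, ∀ᶠ n in atTop, z ∉ {z | siteRing z n ≤ T} :=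
    ae_all_iff.2 fun T => ae_eventually_notMem (tsum_siteRing_le_ne_top T)
  filter_upwards [hpos, hbc] with z hz hz'
  refine ⟨by simpa [siteRing] using hz 0, strictMono_nat_of_lt_succ fun n => ?_,
    tendsto_atTop.2 fun b => ?_⟩
  · rw [siteRing, siteRing, Finset.sum_range_succ _ (n + 1)]
    linarith [hz (n + 1)]
  · obtain ⟨T, hT⟩ := exists_nat_ge b
    filter_upwards [hz' T] with n hn
    exact hT.trans (not_le.1 hn).le

theorem exists_window_siteRing_le (L : ℝ) {p : ℝ≥0∞} (hp : p ≠ 0) :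
    ∃ a b : ℚ, (a : ℝ) < L ∧ L < b ∧
      siteNoiseLaw {z | ∃ n, (a : ℝ) ≤ siteRing z n ∧ siteRing z n ≤ b} ≤ p := by
  have hp2 : p / 2 ≠ 0 := by simpa using hp
  -- Rings of index at least `m` before `L + 1` cost at most `p / 2` by summability. Each of the
  -- first `m` rings hits a window of radius `δ` with probability at most `2δ`, and `δ` is chosen so
  -- that these cost at most `p / 2` too.
  obtain ⟨m, hm⟩ := ((tendsto_order.1 (ENNReal.tendsto_sum_nat_add _
    (tsum_siteRing_le_ne_top (L + 1)))).2 _ (pos_iff_ne_zero.2 hp2)).exists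
  have hlim : Tendsto (fun δ : ℝ => (m : ℝ≥0∞) * ENNReal.ofReal (2 * δ)) (𝓝[>] 0) (𝓝 0) := by
    have h : Tendsto (fun δ : ℝ => ENNReal.ofReal (2 * δ)) (𝓝[>] 0) (𝓝 0) := by
      have : Continuous fun δ : ℝ => ENNReal.ofReal (2 * δ) :=
        ENNReal.continuous_ofReal.comp (by fun_prop)
      simpa using (this.tendsto 0).mono_left nhdsWithin_le_nhds
    simpa using ENNReal.Tendsto.const_mul h (Or.inr (ENNReal.natCast_ne_top m))
  obtain ⟨δ, hδ, hδ1, hδ0⟩ := (((tendsto_order.1 hlim).2 _ (pos_iff_ne_zero.2 hp2)).and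
    ((eventually_nhdsWithin_of_eventually_nhds (eventually_lt_nhds zero_lt_one)).and
      self_mem_nhdsWithin)).exists
  replace hδ0 : 0 < δ := hδ0
  obtain ⟨a, ha, ha'⟩ := exists_rat_btwn (sub_lt_self L hδ0)
  obtain ⟨b, hb, hb'⟩ := exists_rat_btwn (lt_add_of_pos_right L hδ0)
  refine ⟨a, b, ha', hb, ?_⟩
  have hsub : {z | ∃ n, (a : ℝ) ≤ siteRing z n ∧ siteRing z n ≤ b} ⊆
      (⋃ n ∈ Finset.range m, (fun z => siteRing z n) ⁻¹' Set.Icc (L - δ) (L + δ)) ∪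
        ⋃ n, {z | siteRing z (n + m) ≤ L + 1} := by
    rintro z ⟨n, hn, hn'⟩
    rcases lt_or_ge n m with h | h
    · left
      simp only [Set.mem_iUnion]
      exact ⟨n, Finset.mem_range.2 h, by linarith, by linarith⟩
    · right
      rw [Set.mem_iUnion]
      refine ⟨n - m, ?_⟩
      rw [Set.mem_ofPred_eq, Nat.sub_add_cancel h]
      linarith
  calc _ ≤ _ := measure_mono hsub
    _ ≤ _ + _ := measure_union_le _ _
    _ ≤ p / 2 + p / 2 := by
      gcongr
      · refine (measure_biUnion_finset_le _ _).trans (le_trans ?_ hδ.le)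
        have : ∀ n ∈ Finset.range m,
            siteNoiseLaw ((fun z => siteRing z n) ⁻¹' Set.Icc (L - δ) (L + δ)) ≤
              ENNReal.ofReal (2 * δ) := fun n _ => by
          rw [← Measure.map_apply (measurable_siteRing n) measurableSet_Icc]
          refine (map_siteRing_le_volume n _).trans_eq ?_
          rw [Real.volume_Icc]
          congr 1
          ring
        simpa using Finset.sum_le_sum this
      · exact (measure_iUnion_le _).trans hm.le
    _ = p := ENNReal.add_halves p

end Clocks

/-! ### Subcritical percolation and well-foundedness of the dependence -/

section Percolation

open Filter Topology

variable {V : Type*} (G : SimpleGraph V)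

/-- The edges of `G` with both endpoints in `O`. -/
def openGraph (O : Set V) : SimpleGraph V where
  Adj x y := G.Adj x y ∧ x ∈ O ∧ y ∈ O
  symm := ⟨fun _ _ h => ⟨h.1.symm, h.2.2, h.2.1⟩⟩
  loopless := ⟨fun _ h => h.1.ne rfl⟩

variable {G}

theorem openGraph_le (O : Set V) : openGraph G O ≤ G := fun _ _ h => h.1

/-- Only the tail is open in general: the trivial walk may sit at a closed vertex. -/
theorem mem_of_mem_tail_support {O : Set V} {x y : V} (p : (openGraph G O).Walk x y) :
    ∀ v ∈ p.support.tail, v ∈ O := by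
  induction p with
  | nil => simp
  | cons h p ih =>
    intro v hv
    rw [SimpleGraph.Walk.support_cons, List.tail_cons, ← SimpleGraph.Walk.cons_tail_support,
      List.mem_cons] at hv
    rcases hv with rfl | hv
    · exact h.2.2
    · exact ih v hv

variable (G) [G.LocallyFinite]

open Classical in
/-- The vertex sequences of the walks of length `k` that start at `x`. -/
noncomputable def walkSupports : ℕ → V → Finset (List V)
  | 0, x => {[x]}
  | k + 1, x => (G.neighborFinset x).biUnion fun y => (walkSupports k y).image (x :: ·)

theorem card_walkSupports_le {D : ℕ} (hD : ∀ x, G.degree x ≤ D) (k : ℕ) (x : V) :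
    (walkSupports G k x).card ≤ D ^ k := by
  classical
  induction k generalizing x with
  | zero => simp [walkSupports]
  | succ k ih =>
    rw [walkSupports, pow_succ']
    refine Finset.card_biUnion_le.trans ?_
    refine (Finset.sum_le_card_nsmul _ _ (D ^ k)
      fun y _ => Finset.card_image_le.trans (ih y)).trans ?_
    rw [SimpleGraph.card_neighborFinset_eq_degree, smul_eq_mul]
    exact Nat.mul_le_mul_right _ (hD x)

theorem length_of_mem_walkSupports {k : ℕ} {x : V} {l : List V} (hl : l ∈ walkSupports G k x) :
    l.length = k + 1 := by
  classical
  induction k generalizing x l with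
  | zero => simp_all [walkSupports]
  | succ k ih =>
    simp only [walkSupports, Finset.mem_biUnion, Finset.mem_image] at hl
    obtain ⟨y, -, l', hl', rfl⟩ := hl
    simp [ih hl']

variable {G}

theorem support_mem_walkSupports {x y : V} (p : G.Walk x y) :
    p.support ∈ walkSupports G p.length x := by
  classical
  induction p with
  | nil => simp [walkSupports]
  | cons h p ih =>
    simp only [SimpleGraph.Walk.length_cons, SimpleGraph.Walk.support_cons, walkSupports,
      Finset.mem_biUnion, Finset.mem_image, SimpleGraph.mem_neighborFinset]
    exact ⟨_, h, _, ih, rfl⟩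

/-- A longer open path would have a prefix of length exactly `k`, so every vertex of the cluster is
reached by one of the finitely many shorter walks. -/
theorem finite_cluster_of_no_long_path {O : Set V} {x : V} {k : ℕ}
    (h : ¬ ∃ l ∈ walkSupports G k x, l.Nodup ∧ ∀ v ∈ l.tail, v ∈ O) :
    {y | (openGraph G O).Reachable x y}.Finite := by
  have hsub : {y | (openGraph G O).Reachable x y} ⊆
      ⋃ j ∈ Finset.range k, ⋃ l ∈ walkSupports G j x, {z | z ∈ l} := by
    intro y hy
    obtain ⟨p, hp⟩ := SimpleGraph.Reachable.exists_isPath hy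
    have hlt : p.length < k := by
      by_contra hk
      refine h ⟨_, ?_, (hp.take k).support_nodup, mem_of_mem_tail_support _⟩
      have := support_mem_walkSupports ((p.take k).mapLe (openGraph_le O))
      rwa [SimpleGraph.Walk.support_mapLe_eq_support, SimpleGraph.Walk.length_map,
        SimpleGraph.Walk.take_length, min_eq_left (not_lt.1 hk)] at this
    simp only [Set.mem_iUnion]
    refine ⟨p.length, Finset.mem_range.2 hlt, p.support, ?_, p.end_mem_support⟩
    have := support_mem_walkSupports (p.mapLe (openGraph_le O))
    rwa [SimpleGraph.Walk.support_mapLe_eq_support, SimpleGraph.Walk.length_map] at this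
  refine Set.Finite.subset ?_ hsub
  exact Set.Finite.biUnion (Finset.finite_toSet _) fun j _ =>
    Set.Finite.biUnion (Finset.finite_toSet _) fun l _ => l.finite_toSet

theorem noiseLaw_forall_mem {A : Set SiteNoise} (hA : MeasurableSet A) {l : List V}
    (hl : l.Nodup) : noiseLaw V {ω | ∀ v ∈ l, ω v ∈ A} = siteNoiseLaw A ^ l.length := by
  classical
  have h : {ω : V → SiteNoise | ∀ v ∈ l, ω v ∈ A} =
      Set.pi (l.toFinset : Set V) fun _ => A := by
    ext ω; simp [Set.mem_pi]
  rw [h, noiseLaw, Measure.infinitePi_pi _ fun _ _ => hA, Finset.prod_const,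
    List.toFinset_card_of_nodup hl]

/-- Union bound over at most `D ^ k` self-avoiding walks, each open beyond its start with
probability `p ^ k`: as `D * p ≤ 1/2`, the total tends to `0`. -/
theorem ae_finite_cluster [Countable V] {D : ℕ} (hD : ∀ x, G.degree x ≤ D) {A : Set SiteNoise}
    (hA : MeasurableSet A) (hp : D * siteNoiseLaw A ≤ 2⁻¹) :
    ∀ᵐ ω ∂noiseLaw V, ∀ x, {y | (openGraph G {v | ω v ∈ A}).Reachable x y}.Finite := by
  classical
  refine ae_all_iff.2 fun x => ?_
  rw [ae_iff]
  refine le_antisymm ?_ zero_le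
  have hlim : Tendsto (fun k : ℕ => (2⁻¹ : ℝ≥0∞) ^ k) atTop (𝓝 0) :=
    ENNReal.tendsto_pow_atTop_nhds_zero_of_lt_one (by norm_num)
  refine ge_of_tendsto' hlim fun k => ?_
  have hsub : {ω : V → SiteNoise |
        ¬ {y | (openGraph G {v | ω v ∈ A}).Reachable x y}.Finite} ⊆
      ⋃ l ∈ (walkSupports G k x).filter List.Nodup, {ω | ∀ v ∈ l.tail, ω v ∈ A} := by
    intro ω hω
    by_contra hc
    refine hω (finite_cluster_of_no_long_path (k := k) ?_)
    rintro ⟨l, hl, hnd, hO⟩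
    refine hc ?_
    simp only [Set.mem_iUnion]
    exact ⟨l, Finset.mem_filter.2 ⟨hl, hnd⟩, hO⟩
  calc _ ≤ _ := measure_mono hsub
    _ ≤ ∑ l ∈ (walkSupports G k x).filter List.Nodup,
        noiseLaw V {ω | ∀ v ∈ l.tail, ω v ∈ A} := measure_biUnion_finset_le _ _
    _ = ∑ l ∈ (walkSupports G k x).filter List.Nodup, siteNoiseLaw A ^ k := by
      refine Finset.sum_congr rfl fun l hl => ?_
      rw [Finset.mem_filter] at hl
      rw [noiseLaw_forall_mem hA hl.2.tail, List.length_tail, length_of_mem_walkSupports G hl.1,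
        Nat.add_sub_cancel]
    _ ≤ (D ^ k : ℕ) * siteNoiseLaw A ^ k := by
      rw [Finset.sum_const, nsmul_eq_mul]
      gcongr
      exact (Finset.card_filter_le _ _).trans (card_walkSupports_le G hD k x)
    _ = (D * siteNoiseLaw A) ^ k := by rw [mul_pow, Nat.cast_pow]
    _ ≤ 2⁻¹ ^ k := by gcongr

omit [G.LocallyFinite] in
theorem wellFounded_of_finite_clusters {ω : V → SiteNoise} {p : ℝ≥0∞} (hp : p ≠ 0)
    (hω : ∀ x, 0 < ringTime ω x 0 ∧ StrictMono (ringTime ω x) ∧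
      Tendsto (ringTime ω x) atTop atTop)
    (hc : ∀ a b : ℚ, siteNoiseLaw {z | ∃ n, (a : ℝ) ≤ siteRing z n ∧ siteRing z n ≤ b} ≤ p →
      ∀ x, {y | (openGraph G {v | ∃ n, (a : ℝ) ≤ ringTime ω v n ∧ ringTime ω v n ≤ b}).Reachable
        x y}.Finite) :
    WellFounded fun p q : V × ℕ =>
      (p.1 = q.1 ∨ G.Adj q.1 p.1) ∧ ringTime ω p.1 p.2 < ringTime ω q.1 q.2 := by
  rw [wellFounded_iff_isEmpty_descending_chain]
  refine ⟨fun ⟨f, hf⟩ => ?_⟩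
  set t : ℕ → ℝ := fun n => ringTime ω (f n).1 (f n).2 with ht
  have hanti : StrictAnti t := strictAnti_nat_of_succ_lt fun n => (hf n).2
  have hbdd : BddBelow (Set.range t) := by
    refine ⟨0, ?_⟩
    rintro _ ⟨n, rfl⟩
    exact (hω _).1.le.trans ((hω _).2.1.monotone (Nat.zero_le _))
  have hlim := tendsto_atTop_ciInf hanti.antitone hbdd
  -- Rational endpoints leave only countably many windows, so one null set serves every possible
  -- limit point.
  obtain ⟨a, b, ha, hb, hab⟩ := exists_window_siteRing_le (⨅ n, t n) hp
  obtain ⟨N, hN⟩ := eventually_atTop.1 ((tendsto_order.1 hlim).2 _ hb)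
  have hopen : ∀ n ≥ N, (a : ℝ) ≤ t n ∧ t n ≤ b := fun n hn =>
    ⟨ha.le.trans (ciInf_le hbdd n), (hN n hn).le⟩
  set O := {v | ∃ n, (a : ℝ) ≤ ringTime ω v n ∧ ringTime ω v n ≤ b} with hO
  have hreach : ∀ k, (openGraph G O).Reachable (f N).1 (f (N + k)).1 := by
    intro k
    induction k with
    | zero => exact SimpleGraph.Reachable.refl _
    | succ k ih =>
      rcases (hf (N + k)).1 with h | h
      · rw [← Nat.add_assoc, h]; exact ih
      · refine ih.trans (SimpleGraph.Adj.reachable ⟨h, ?_, ?_⟩)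
        · exact ⟨_, hopen (N + k) (by omega)⟩
        · exact ⟨_, hopen (N + k + 1) (by omega)⟩
  have hfin : (⋃ y ∈ {y | (openGraph G O).Reachable (f N).1 y},
      (fun n => (y, n)) '' {n | n < countUpTo (ringTime ω y) b}).Finite :=
    (hc a b hab (f N).1).biUnion fun y _ => (Set.finite_lt_nat _).image _
  refine Set.infinite_of_injective_forall_mem (f := fun k => f (N + k)) ?_ ?_ hfin
  · intro i j hij
    have : t (N + i) = t (N + j) := by
      simp only [ht]
      rw [show f (N + i) = f (N + j) from hij]
    have := hanti.injective this
    omega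
  · intro k
    simp only [Set.mem_iUnion]
    exact ⟨(f (N + k)).1, hreach k, (f (N + k)).2,
      (lt_countUpTo (hω _).2.1 (hω _).2.2).2 (hopen (N + k) (by omega)).2, rfl⟩

omit [G.LocallyFinite] in
-- The two clocks are independent and ring times have no atoms, so Fubini applies.
theorem ae_ringTime_ne {x y : V} (hxy : x ≠ y) (m n : ℕ) :
    ∀ᵐ ω ∂noiseLaw V, ringTime ω x m ≠ ringTime ω y n := by
  have hset : MeasurableSet {z : SiteNoise × SiteNoise | siteRing z.1 m = siteRing z.2 n} :=
    measurableSet_eq_fun ((measurable_siteRing m).comp measurable_fst)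
      ((measurable_siteRing n).comp measurable_snd)
  have h0 : ∀ c, siteNoiseLaw {z | siteRing z m = c} = 0 := fun c => by
    have : siteNoiseLaw ((fun z => siteRing z m) ⁻¹' {c}) = 0 := by
      rw [← Measure.map_apply (measurable_siteRing m) (measurableSet_singleton c)]
      exact le_antisymm ((map_siteRing_le_volume m _).trans_eq (by simp)) zero_le
    exact this
  have hprod : (siteNoiseLaw.prod siteNoiseLaw)
      {z : SiteNoise × SiteNoise | siteRing z.1 m = siteRing z.2 n} = 0 := by
    rw [Measure.prod_apply_symm hset]
    exact (lintegral_congr fun z => h0 (siteRing z n)).trans lintegral_zero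
  rw [← Measure.infinitePi_map_eval_prod (P := fun _ : V => siteNoiseLaw) hxy,
    Measure.map_apply (by fun_prop) hset] at hprod
  rw [ae_iff]
  simpa only [not_not] using! hprod

theorem ae_isGoodNoise [Countable V] {D : ℕ} (hD : ∀ x, G.degree x ≤ D) :
    ∀ᵐ ω ∂noiseLaw V, IsGoodNoise G ω := by
  have h₁ : ∀ᵐ ω ∂noiseLaw V, ∀ x, 0 < ringTime ω x 0 ∧ StrictMono (ringTime ω x) ∧
      Tendsto (ringTime ω x) atTop atTop := ae_all_iff.2 fun x =>
    (measurePreserving_eval_infinitePi (fun _ : V => siteNoiseLaw)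
      x).quasiMeasurePreserving.ae ae_siteRing
  have h₂ : ∀ᵐ ω ∂noiseLaw V, ∀ x y, x ≠ y → ∀ m n, ringTime ω x m ≠ ringTime ω y n := by
    simp only [ae_all_iff]
    exact fun x y hxy m n => ae_ringTime_ne hxy m n
  -- The threshold makes `D * p ≤ 1/2`; using `D + 1` lets the cancellation below cover `D = 0`.
  have hp : (2 * (D + 1) : ℝ≥0∞)⁻¹ ≠ 0 := by simp [ENNReal.mul_eq_top]
  have h₃ : ∀ᵐ ω ∂noiseLaw V, ∀ a b : ℚ,
      siteNoiseLaw {z | ∃ n, (a : ℝ) ≤ siteRing z n ∧ siteRing z n ≤ b} ≤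
        (2 * (D + 1) : ℝ≥0∞)⁻¹ →
      ∀ x, {y | (openGraph G {v | ∃ n, (a : ℝ) ≤ ringTime ω v n ∧
        ringTime ω v n ≤ b}).Reachable x y}.Finite := by
    simp only [ae_all_iff]
    intro a b hab
    have hA : MeasurableSet {z | ∃ n, (a : ℝ) ≤ siteRing z n ∧ siteRing z n ≤ b} := by
      simp only [Set.ofPred_exists]
      exact MeasurableSet.iUnion fun n => (measurable_siteRing n) measurableSet_Icc
    refine ae_all_iff.1 (ae_finite_cluster hD hA ?_)
    calc (D : ℝ≥0∞) * _ ≤ ((D : ℝ≥0∞) + 1) * (2 * ((D : ℝ≥0∞) + 1))⁻¹ := by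
          gcongr
          exact le_self_add
      _ = 2⁻¹ := by
          rw [ENNReal.mul_inv (by simp) (by simp), mul_comm, mul_assoc,
            ENNReal.inv_mul_cancel (by simp) (by simp), mul_one]
  filter_upwards [h₁, h₂, h₃] with ω hω₁ hω₂ hω₃
  exact ⟨fun x => (hω₁ x).1, fun x => (hω₁ x).2.1, fun x => (hω₁ x).2.2, hω₂,
    wellFounded_of_finite_clusters hp hω₁ hω₃⟩

end Percolation

/-! ### Degree and translation symmetry of the lattice -/

section Lattice

variable {d : ℕ}

theorem latticeGraph_adj_add_right (x y a : Fin d → ℤ) :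
    (latticeGraph d).Adj (x + a) (y + a) ↔ (latticeGraph d).Adj x y := by
  simp [latticeGraph]

theorem latticeGraph_adj_zero_neg (y : Fin d → ℤ) :
    (latticeGraph d).Adj 0 (-y) ↔ (latticeGraph d).Adj 0 y := by
  simp [latticeGraph]

theorem latticeGraph_neighborFinset_add (x a : Fin d → ℤ) :
    (latticeGraph d).neighborFinset (x + a) =
      ((latticeGraph d).neighborFinset x).map (Equiv.addRight a).toEmbedding := by
  ext y
  rw [SimpleGraph.mem_neighborFinset, Finset.mem_map_equiv, SimpleGraph.mem_neighborFinset,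
    ← latticeGraph_adj_add_right x _ a]
  simp

theorem latticeGraph_degree_add (x a : Fin d → ℤ) :
    (latticeGraph d).degree (x + a) = (latticeGraph d).degree x := by
  rw [← SimpleGraph.card_neighborFinset_eq_degree, latticeGraph_neighborFinset_add,
    Finset.card_map, SimpleGraph.card_neighborFinset_eq_degree]

theorem latticeGraph_degree_le (x : Fin d → ℤ) : (latticeGraph d).degree x ≤ 2 * d := by
  rw [← zero_add x, latticeGraph_degree_add, ← SimpleGraph.card_neighborFinset_eq_degree]
  have hsub : (latticeGraph d).neighborFinset 0 ⊆
      (Finset.univ ×ˢ {1, -1} : Finset (Fin d × ℤ)).image fun p => Pi.single p.1 p.2 := by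
    intro y hy
    have hy : ∑ i, |y i| = 1 := by
      simpa [latticeGraph] using (SimpleGraph.mem_neighborFinset _ _ _).1 hy
    obtain ⟨i, -, hi⟩ : ∃ i ∈ Finset.univ, |y i| ≠ 0 :=
      Finset.exists_ne_zero_of_sum_ne_zero (by rw [hy]; exact one_ne_zero)
    have hi' : |y i| = 1 := by
      have := Finset.single_le_sum (f := fun j => |y j|) (fun j _ => abs_nonneg (y j))
        (Finset.mem_univ i)
      have := abs_nonneg (y i)
      omega
    have hj : ∀ j, j ≠ i → y j = 0 := fun j hji => by
      have := Finset.add_le_sum (f := fun j => |y j|) (s := Finset.univ)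
        (fun j _ => abs_nonneg (y j)) (Finset.mem_univ i) (Finset.mem_univ j) hji.symm
      rw [hy, hi'] at this
      exact abs_nonpos_iff.1 (by linarith)
    refine Finset.mem_image.2 ⟨(i, y i), ?_, ?_⟩
    · rcases (abs_eq zero_le_one).1 hi' with h | h <;> simp [h]
    · funext j
      by_cases h : j = i
      · subst h; simp
      · simp [h, hj j h]
  calc _ ≤ _ := Finset.card_le_card hsub
    _ ≤ _ := Finset.card_image_le
    _ = 2 * d := by rw [Finset.card_product]; simp [mul_comm]

/-- Translation of the noise by `a`. -/
def shiftNoise (a : Fin d → ℤ) (ω : (Fin d → ℤ) → SiteNoise) : (Fin d → ℤ) → SiteNoise :=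
  fun v => ω (v + a)

theorem measurePreserving_shiftNoise (a : Fin d → ℤ) :
    MeasurePreserving (shiftNoise a) (noiseLaw (Fin d → ℤ)) (noiseLaw (Fin d → ℤ)) :=
  ⟨measurable_pi_lambda _ fun v => measurable_pi_apply (v + a),
    Measure.map_infinitePi_infinitePi_of_inj (P := fun _ : Fin d → ℤ => siteNoiseLaw)
      (add_left_injective a)⟩

theorem medianUpdate_shift (ξ : (Fin d → ℤ) → I) (x a : Fin d → ℤ) (b : Bool) :
    medianUpdate (latticeGraph d) (fun v => ξ (v + a)) x b =
      medianUpdate (latticeGraph d) ξ (x + a) b := by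
  have : sortedOpinions (latticeGraph d) (fun v => ξ (v + a)) x =
      sortedOpinions (latticeGraph d) ξ (x + a) := by
    rw [sortedOpinions, sortedOpinions, latticeGraph_neighborFinset_add, Finset.map_val,
      Multiset.map_map]
    rfl
  rw [medianUpdate, medianUpdate, this, latticeGraph_degree_add]

/-- Covariance of the truncated recursion holds for every noise, so no exceptional set enters the
symmetry argument. -/
theorem approxTable_shift (ω : (Fin d → ℤ) → SiteNoise) (a : Fin d → ℤ) (k : ℕ) (x : Fin d → ℤ)
    (n : ℕ) : approxTable (latticeGraph d) (shiftNoise a ω) k x n =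
      approxTable (latticeGraph d) ω k (x + a) n := by
  induction k generalizing x n with
  | zero => rfl
  | succ k ih =>
    cases n with
    | zero => rfl
    | succ n =>
      rw [approxTable, approxTable, ← medianUpdate_shift]
      simp only [ih]
      rfl

end Lattice

/-! ### Measurability of counts and of the truncated recursion -/

section Measurability

theorem measurable_sInf_nat {Ω : Type*} [MeasurableSpace Ω] {p : Ω → ℕ → Prop}
    (hp : ∀ m, MeasurableSet {ω | p ω m}) : Measurable fun ω => sInf {m | p ω m} := by
  refine measurable_of_Ioi fun k => ?_
  -- Nonemptiness must be required separately, because `sInf ∅ = 0`.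
  have : (fun ω => sInf {m | p ω m}) ⁻¹' Set.Ioi k =
      (⋃ m, {ω | p ω m}) ∩ ⋂ j ∈ Set.Iic k, {ω | p ω j}ᶜ := by
    ext ω
    simp only [Set.mem_preimage, Set.mem_Ioi, Set.mem_inter_iff, Set.mem_iUnion, Set.mem_iInter,
      Set.mem_Iic, Set.mem_compl_iff, Set.mem_ofPred_eq]
    constructor
    · intro h
      exact ⟨Nat.nonempty_of_pos_sInf (k.zero_le.trans_lt h),
        fun j hj => Nat.notMem_of_lt_sInf (hj.trans_lt h)⟩
    · rintro ⟨hne, hk⟩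
      by_contra hc
      exact hk _ (not_lt.1 hc) (Nat.sInf_mem (s := {m | p ω m}) hne)
  rw [this]
  exact (MeasurableSet.iUnion hp).inter
    (MeasurableSet.biInter (Set.to_countable _) fun j _ => (hp j).compl)

theorem Measurable.comp_nat {Ω β : Type*} [MeasurableSpace Ω] [MeasurableSpace β]
    {f : ℕ → Ω → β} {c : Ω → ℕ} (hf : ∀ n, Measurable (f n)) (hc : Measurable c) :
    Measurable fun ω => f (c ω) ω :=
  (measurable_from_prod_countable_right (f := fun p : ℕ × Ω => f p.1 p.2) hf).comp
    (hc.prodMk measurable_id)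

variable {V : Type*}

theorem measurable_ringTime (x : V) (n : ℕ) : Measurable fun ω => ringTime ω x n :=
  (measurable_siteRing n).comp (measurable_pi_apply x)

theorem measurable_countBefore_ringTime (x y : V) (n : ℕ) :
    Measurable fun ω => countBefore (ringTime ω y) (ringTime ω x n) :=
  measurable_sInf_nat fun m => measurableSet_le (measurable_ringTime x n) (measurable_ringTime y m)

theorem measurable_countUpTo_ringTime (x : V) (t : ℝ) :
    Measurable fun ω => countUpTo (ringTime ω x) t :=
  measurable_sInf_nat fun m => measurableSet_lt measurable_const (measurable_ringTime x m)

theorem measurable_approxTable (G : SimpleGraph V) [G.LocallyFinite] (k : ℕ) (x : V) (n : ℕ) :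
    Measurable fun ω => approxTable G ω k x n := by
  induction k generalizing x n with
  | zero => exact measurable_fst.comp (measurable_pi_apply x)
  | succ k ih =>
    cases n with
    | zero => exact measurable_fst.comp (measurable_pi_apply x)
    | succ n =>
      refine measurable_medianUpdate G (fun y => ?_) ?_ x
      · exact Measurable.comp_nat (fun m => ih y m) (measurable_countBefore_ringTime x y n)
      · have h : Measurable fun z : SiteNoise => z.2.2 n := by fun_prop
        exact h.comp (measurable_pi_apply x)

end Measurability

/-! ### Energy gains per edge and per flip -/

section Energy

open Filter Topology

variable {V : Type*} (G : SimpleGraph V) [G.LocallyFinite]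

/-- The opinion of `x` after its first `n` updates, as a real number. -/
noncomputable def opinionTable (ω : V → SiteNoise) (x : V) (n : ℕ) : ℝ :=
  limsup (fun k => (approxTable G ω k x n : ℝ)) atTop

/-- The change of `|η(y) - η(x)|` at the `n`-th update of `x`. -/
noncomputable def edgeJump (ω : V → SiteNoise) (x y : V) (n : ℕ) : ℝ :=
  |opinionTable G ω y (countBefore (ringTime ω y) (ringTime ω x n)) - opinionTable G ω x (n + 1)| -
    |opinionTable G ω y (countBefore (ringTime ω y) (ringTime ω x n)) - opinionTable G ω x n|

/-- The total change of `|η(y) - η(x)|` at the updates of `x` up to time `t`. -/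
noncomputable def edgeGain (t : ℝ) (ω : V → SiteNoise) (x y : V) : ℝ :=
  ∑ n ∈ Finset.range (countUpTo (ringTime ω x) t), edgeJump G ω x y n

/-- The change of the local energy at `x` at the `n`-th update of `x`. -/
noncomputable def energyJump (ω : V → SiteNoise) (x : V) (n : ℕ) : ℝ :=
  ∑ y ∈ G.neighborFinset x, edgeJump G ω x y n

theorem measurable_opinionTable (x : V) (n : ℕ) : Measurable fun ω => opinionTable G ω x n :=
  Measurable.limsup fun k => measurable_subtype_coe.comp (measurable_approxTable G k x n)

theorem measurable_edgeJump (x y : V) (n : ℕ) : Measurable fun ω => edgeJump G ω x y n := by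
  have h : Measurable fun ω =>
      opinionTable G ω y (countBefore (ringTime ω y) (ringTime ω x n)) :=
    Measurable.comp_nat (fun m => measurable_opinionTable G y m)
      (measurable_countBefore_ringTime x y n)
  exact (h.sub (measurable_opinionTable G x _)).abs.sub
    (h.sub (measurable_opinionTable G x _)).abs

theorem measurable_edgeGain (t : ℝ) (x y : V) : Measurable fun ω => edgeGain G t ω x y :=
  Measurable.comp_nat (f := fun N ω => ∑ n ∈ Finset.range N, edgeJump G ω x y n)
    (fun _ => Finset.measurable_sum _ fun n _ => measurable_edgeJump G x y n)
    (measurable_countUpTo_ringTime x t)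

theorem measurable_energyJump (x : V) (n : ℕ) : Measurable fun ω => energyJump G ω x n :=
  Finset.measurable_sum _ fun y _ => measurable_edgeJump G x y n

theorem edgeGain_shift {d : ℕ} (t : ℝ) (ω : (Fin d → ℤ) → SiteNoise) (a x y : Fin d → ℤ) :
    edgeGain (latticeGraph d) t (shiftNoise a ω) x y =
      edgeGain (latticeGraph d) t ω (x + a) (y + a) := by
  have h : ∀ x n, opinionTable (latticeGraph d) (shiftNoise a ω) x n =
      opinionTable (latticeGraph d) ω (x + a) n := fun x n => by
    simp only [opinionTable, approxTable_shift]
  simp only [edgeGain, edgeJump, h]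
  rfl

variable {G} {ω : V → SiteNoise}

namespace IsGoodNoise

variable (hω : IsGoodNoise G ω)
include hω

/-- For good noise the approximations are eventually constant. Defining the table by a `limsup`
keeps it measurable and translation covariant for all noise. -/
theorem opinionTable_eq {w : V → ℕ → I} (hw : IsUpdateTable G ω w) (x : V) (n : ℕ) :
    opinionTable G ω x n = w x n := by
  refine Tendsto.limsup_eq (tendsto_const_nhds.congr' ?_)
  filter_upwards [hω.approxTable_eventually_eq hw x n] with k hk
  rw [hk]

theorem opinionTable_mem (x : V) (n : ℕ) : opinionTable G ω x n ∈ Set.Icc (0 : ℝ) 1 := by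
  obtain ⟨w, hw⟩ := hω.exists_isUpdateTable
  rw [hω.opinionTable_eq hw]
  exact (w x n).2

theorem abs_sub_opinionTable_le (x y : V) (m n : ℕ) :
    |opinionTable G ω y m - opinionTable G ω x n| ≤ 1 := by
  have h₁ := hω.opinionTable_mem x n
  have h₂ := hω.opinionTable_mem y m
  exact abs_le.2 ⟨by linarith [h₁.2, h₂.1], by linarith [h₁.1, h₂.2]⟩

theorem abs_edgeJump_le (x y : V) (n : ℕ) : |edgeJump G ω x y n| ≤ 1 := by
  have h₁ := hω.abs_sub_opinionTable_le x y (countBefore (ringTime ω y) (ringTime ω x n)) (n + 1)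
  have h₂ := hω.abs_sub_opinionTable_le x y (countBefore (ringTime ω y) (ringTime ω x n)) n
  rw [edgeJump]
  exact abs_le.2 ⟨by linarith [abs_nonneg (opinionTable G ω y
    (countBefore (ringTime ω y) (ringTime ω x n)) - opinionTable G ω x (n + 1))],
    by linarith [abs_nonneg (opinionTable G ω y
    (countBefore (ringTime ω y) (ringTime ω x n)) - opinionTable G ω x n)]⟩

theorem abs_edgeGain_le (t : ℝ) (x y : V) :
    |edgeGain G t ω x y| ≤ countUpTo (ringTime ω x) t := by
  refine (Finset.abs_sum_le_sum_abs _ _).trans ?_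
  simpa using Finset.sum_le_sum fun n (_ : n ∈ Finset.range (countUpTo (ringTime ω x) t)) =>
    hω.abs_edgeJump_le x y n

/-- The rings of the two endpoints, in order of time, telescope the change of `|η(y) - η(x)|`, which
starts at most `1` and ends nonnegative. -/
theorem neg_one_le_edgeGain_add {x y : V} (hxy : x ≠ y) (t : ℝ) :
    -1 ≤ edgeGain G t ω x y + edgeGain G t ω y x := by
  have hsx := hω.strictMono x
  have hsx' := hω.tendsto x
  have hsy := hω.strictMono y
  have hsy' := hω.tendsto y
  have h := telescope_two_clocks hsx hsx' hsy hsy' (hω.ne x y hxy)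
    (fun N M => |opinionTable G ω y M - opinionTable G ω x N|)
    (countUpTo (ringTime ω x) t) (countUpTo (ringTime ω y) t)
    (fun n hn => ((lt_countUpTo hsx hsx').1 hn).trans_lt
      (not_le.1 fun hc => lt_irrefl _ ((lt_countUpTo hsy hsy').2 hc)))
    (fun m hm => ((lt_countUpTo hsy hsy').1 hm).trans_lt
      (not_le.1 fun hc => lt_irrefl _ ((lt_countUpTo hsx hsx').2 hc)))
  have h₁ : edgeGain G t ω y x = ∑ m ∈ Finset.range (countUpTo (ringTime ω y) t),
      (|opinionTable G ω y (m + 1) -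
          opinionTable G ω x (countBefore (ringTime ω x) (ringTime ω y m))| -
        |opinionTable G ω y m -
          opinionTable G ω x (countBefore (ringTime ω x) (ringTime ω y m))|) :=
    Finset.sum_congr rfl fun m _ => by
      rw [edgeJump, abs_sub_comm, abs_sub_comm (opinionTable G ω x _)]
  rw [h₁, edgeGain]
  simp only [edgeJump]
  rw [← h]
  linarith [hω.abs_sub_opinionTable_le x y 0 0, abs_nonneg (opinionTable G ω y
    (countUpTo (ringTime ω y) t) - opinionTable G ω x (countUpTo (ringTime ω x) t))]

theorem energyJump_nonpos (x : V) (n : ℕ) : energyJump G ω x n ≤ 0 := by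
  obtain ⟨w, hw⟩ := hω.exists_isUpdateTable
  simp only [energyJump, edgeJump, hω.opinionTable_eq hw, hw.succ]
  rw [Finset.sum_sub_distrib, sub_nonpos]
  exact medianUpdate_minimizes G _ x _ _

/-- No neighbour rings at the same time as `x`, so across the flip only the opinion of `x` moves,
from state `n` to state `n + 1`. -/
theorem energyFlips_eq {η : ℝ≥0 → V → I} (hη : IsMedianTrajectory G ω η) (x : V) (ε : ℝ) :
    energyFlips G ω η x ε = {n | ε ≤ |energyJump G ω x n|} := by
  obtain ⟨w, hw, rfl⟩ := (hω.isMedianTrajectory_iff η).1 hη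
  ext n
  have key : ∀ t : ℝ≥0, (t : ℝ) = ringTime ω x n →
      localEnergy G x (fun y => w y (countUpTo (ringTime ω y) t)) -
        localEnergy G x (justBefore
          (fun (t : ℝ≥0) y => w y (countUpTo (ringTime ω y) t)) t) = energyJump G ω x n := by
    intro t ht
    have hpos : 0 < t := by rw [← NNReal.coe_pos, ht]; exact hω.ringTime_pos x n
    rw [hω.justBefore_eq w hpos, localEnergy, localEnergy, ← Finset.sum_sub_distrib]
    refine Finset.sum_congr rfl fun y hy => ?_
    have hne : y ≠ x := ((G.mem_neighborFinset x y).1 hy).ne'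
    simp only [ht, edgeJump, hω.opinionTable_eq hw,
      countUpTo_self (hω.strictMono x) (hω.tendsto x),
      countBefore_self (hω.strictMono x) (hω.tendsto x),
      countUpTo_eq_countBefore (hω.strictMono y) (hω.tendsto y)
        (fun m => hω.ne y x hne m n)]
  constructor
  · rintro ⟨t, ht, h⟩
    rwa [key t ht] at h
  · intro h
    have ht := Real.coe_toNNReal _ (hω.ringTime_pos x n).le
    exact ⟨_, ht, by rw [key _ ht]; exact h⟩

end IsGoodNoise

end Energy

/-! ### Mass transport and the expected number of flips -/

section Expectation

open Filter Topology

theorem lintegral_countUpTo_lt_top {V : Type*} [Countable V] {G : SimpleGraph V}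
    [G.LocallyFinite] (hG : ∀ᵐ ω ∂noiseLaw V, IsGoodNoise G ω) (x : V) (t : ℝ) :
    ∫⁻ ω, (countUpTo (ringTime ω x) t : ℝ≥0∞) ∂noiseLaw V < ∞ := by
  have hmeas : ∀ n, MeasurableSet {ω : V → SiteNoise | ringTime ω x n ≤ t} := fun n =>
    measurableSet_le (measurable_ringTime x n) measurable_const
  have h : ∀ᵐ ω ∂noiseLaw V, (countUpTo (ringTime ω x) t : ℝ≥0∞) =
      ∑' n, {ω : V → SiteNoise | ringTime ω x n ≤ t}.indicator 1 ω := by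
    filter_upwards [hG] with ω hω
    rw [tsum_eq_sum (s := Finset.range (countUpTo (ringTime ω x) t))]
    · rw [Finset.sum_congr rfl (g := fun _ => 1)]
      · simp
      · intro n hn
        exact Set.indicator_of_mem (s := {ω : V → SiteNoise | ringTime ω x n ≤ t})
          ((lt_countUpTo (hω.strictMono x) (hω.tendsto x)).1 (Finset.mem_range.1 hn)) 1
    · intro n hn
      refine Set.indicator_of_notMem (s := {ω : V → SiteNoise | ringTime ω x n ≤ t}) ?_ 1
      intro hc
      exact hn (Finset.mem_range.2 ((lt_countUpTo (hω.strictMono x) (hω.tendsto x)).2 hc))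
  rw [lintegral_congr_ae h, lintegral_tsum fun n =>
    (measurable_one.indicator (hmeas n)).aemeasurable]
  simp only [lintegral_indicator_one (hmeas _)]
  have hsite : ∀ n, noiseLaw V {ω | ringTime ω x n ≤ t} = siteNoiseLaw {z | siteRing z n ≤ t} :=
    fun n => (measurePreserving_eval_infinitePi (fun _ : V => siteNoiseLaw) x).measure_preimage
      (measurableSet_le (measurable_siteRing n) measurable_const).nullMeasurableSet
  simp only [hsite]
  exact (tsum_siteRing_le_ne_top t).lt_top

theorem integrable_edgeGain {V : Type*} [Countable V] {G : SimpleGraph V}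
    [G.LocallyFinite] (hG : ∀ᵐ ω ∂noiseLaw V, IsGoodNoise G ω) (t : ℝ) (x y : V) :
    Integrable (fun ω => edgeGain G t ω x y) (noiseLaw V) := by
  refine ⟨(measurable_edgeGain G t x y).aestronglyMeasurable, ?_⟩
  refine lt_of_le_of_lt (lintegral_mono_ae ?_) (lintegral_countUpTo_lt_top hG x t)
  filter_upwards [hG] with ω hω
  rw [← ofReal_norm, ← ENNReal.ofReal_natCast]
  exact ENNReal.ofReal_le_ofReal (hω.abs_edgeGain_le t x y)

variable {d : ℕ}

theorem ae_isGoodNoise_latticeGraph (d : ℕ) :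
    ∀ᵐ ω ∂noiseLaw (Fin d → ℤ), IsGoodNoise (latticeGraph d) ω :=
  ae_isGoodNoise latticeGraph_degree_le

/-- Translation by `y` carries the ordered pair `(0, -y)` to `(y, 0)` and preserves the law of the
noise. -/
theorem integral_edgeGain_swap (t : ℝ) (y : Fin d → ℤ) :
    ∫ ω, edgeGain (latticeGraph d) t ω y 0 ∂noiseLaw (Fin d → ℤ) =
      ∫ ω, edgeGain (latticeGraph d) t ω 0 (-y) ∂noiseLaw (Fin d → ℤ) := by
  have hmp := measurePreserving_shiftNoise y
  conv_rhs => rw [← hmp.map_eq]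
  rw [integral_map hmp.aemeasurable (measurable_edgeGain _ t _ _).aestronglyMeasurable]
  simp only [edgeGain_shift, zero_add, neg_add_cancel]

theorem neg_le_sum_integral_edgeGain (t : ℝ) :
    -(d : ℝ) ≤ ∑ y ∈ (latticeGraph d).neighborFinset 0,
      ∫ ω, edgeGain (latticeGraph d) t ω 0 y ∂noiseLaw (Fin d → ℤ) := by
  have hG := ae_isGoodNoise_latticeGraph d
  have : IsProbabilityMeasure (noiseLaw (Fin d → ℤ)) := by unfold noiseLaw; infer_instance
  have hswap : ∑ y ∈ (latticeGraph d).neighborFinset 0,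
        ∫ ω, edgeGain (latticeGraph d) t ω y 0 ∂noiseLaw (Fin d → ℤ) =
      ∑ y ∈ (latticeGraph d).neighborFinset 0,
        ∫ ω, edgeGain (latticeGraph d) t ω 0 y ∂noiseLaw (Fin d → ℤ) := by
    -- The reflection `y ↦ -y` permutes the neighbours of `0`.
    refine Finset.sum_equiv (Equiv.neg _) (fun y => ?_) fun y _ => integral_edgeGain_swap t y
    simp only [SimpleGraph.mem_neighborFinset, Equiv.neg_apply]
    exact (latticeGraph_adj_zero_neg y).symm
  have hpair : ∀ y ∈ (latticeGraph d).neighborFinset 0, -1 ≤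
      ∫ ω, edgeGain (latticeGraph d) t ω 0 y ∂noiseLaw (Fin d → ℤ) +
        ∫ ω, edgeGain (latticeGraph d) t ω y 0 ∂noiseLaw (Fin d → ℤ) := by
    intro y hy
    rw [← integral_add (integrable_edgeGain hG t 0 y) (integrable_edgeGain hG t y 0)]
    have hne : (0 : Fin d → ℤ) ≠ y := (((latticeGraph d).mem_neighborFinset 0 y).1 hy).ne
    calc (-1 : ℝ) = ∫ _, (-1 : ℝ) ∂noiseLaw (Fin d → ℤ) := by simp
      _ ≤ _ := integral_mono_ae (integrable_const _)
        ((integrable_edgeGain hG t 0 y).add (integrable_edgeGain hG t y 0))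
        (hG.mono fun ω hω => hω.neg_one_le_edgeGain_add hne t)
  have hsum := Finset.sum_le_sum hpair
  rw [Finset.sum_add_distrib, hswap, Finset.sum_const, SimpleGraph.card_neighborFinset_eq_degree,
    nsmul_eq_mul] at hsum
  have hdeg : ((latticeGraph d).degree 0 : ℝ) ≤ 2 * d := by
    exact_mod_cast latticeGraph_degree_le (0 : Fin d → ℤ)
  linarith

theorem lintegral_energyLoss_le (t : ℝ) {ε : ℝ} (hε : 0 < ε) :
    ∫⁻ ω, ENNReal.ofReal ((∑ n ∈ Finset.range (countUpTo (ringTime ω 0) t),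
      -energyJump (latticeGraph d) ω 0 n) / ε) ∂noiseLaw (Fin d → ℤ) ≤ ENNReal.ofReal (d / ε) := by
  have hG := ae_isGoodNoise_latticeGraph d
  have hloss : ∀ ω, ∑ n ∈ Finset.range (countUpTo (ringTime ω 0) t),
      -energyJump (latticeGraph d) ω 0 n =
        -∑ y ∈ (latticeGraph d).neighborFinset 0, edgeGain (latticeGraph d) t ω 0 y := fun ω => by
    rw [Finset.sum_neg_distrib]
    simp only [energyJump, edgeGain]
    rw [Finset.sum_comm]
  have hint : Integrable (fun ω => (∑ n ∈ Finset.range (countUpTo (ringTime ω 0) t),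
      -energyJump (latticeGraph d) ω 0 n) / ε) (noiseLaw (Fin d → ℤ)) := by
    simp only [hloss]
    exact (integrable_finsetSum _ fun y _ => integrable_edgeGain hG t 0 y).neg.div_const ε
  have hnonneg : 0 ≤ᵐ[noiseLaw (Fin d → ℤ)] fun ω =>
      (∑ n ∈ Finset.range (countUpTo (ringTime ω 0) t),
        -energyJump (latticeGraph d) ω 0 n) / ε :=
    hG.mono fun ω hω => div_nonneg
      (Finset.sum_nonneg fun n _ => neg_nonneg.2 (hω.energyJump_nonpos 0 n)) hε.le
  rw [← ofReal_integral_eq_lintegral_ofReal hint hnonneg]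
  refine ENNReal.ofReal_le_ofReal ?_
  simp only [hloss]
  rw [integral_div, integral_neg, integral_finsetSum _ fun y _ => integrable_edgeGain hG t 0 y]
  gcongr
  linarith [neg_le_sum_integral_edgeGain (d := d) t]

theorem measurable_encard_energyJump (ε : ℝ) :
    Measurable fun ω => ({n | ε ≤ |energyJump (latticeGraph d) ω 0 n|}.encard : ℝ≥0∞) := by
  have h : (fun ω => ({n | ε ≤ |energyJump (latticeGraph d) ω 0 n|}.encard : ℝ≥0∞)) =
      fun ω => ∑' n, {ω | ε ≤ |energyJump (latticeGraph d) ω 0 n|}.indicator 1 ω := by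
    funext ω
    rw [← ENNReal.tsum_set_one, tsum_subtype _ fun _ => (1 : ℝ≥0∞)]
    rfl
  rw [h]
  exact Measurable.tsum fun n => measurable_one.indicator
    (measurableSet_le measurable_const (measurable_energyJump _ 0 n).abs)

theorem lintegral_encard_energyJump_le {ε : ℝ} (hε : 0 < ε) :
    ∫⁻ ω, ({n | ε ≤ |energyJump (latticeGraph d) ω 0 n|}.encard : ℝ≥0∞) ∂noiseLaw (Fin d → ℤ)
      ≤ ENNReal.ofReal (d / ε) := by
  have hG := ae_isGoodNoise_latticeGraph d
  have hmeas : ∀ T : ℕ, Measurable fun ω : (Fin d → ℤ) → SiteNoise =>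
      ENNReal.ofReal ((∑ n ∈ Finset.range (countUpTo (ringTime ω 0) T),
        -energyJump (latticeGraph d) ω 0 n) / ε) := fun T =>
    ((Measurable.comp_nat (f := fun N ω => ∑ n ∈ Finset.range N,
        -energyJump (latticeGraph d) ω 0 n)
      (fun _ => Finset.measurable_sum _ fun n _ => (measurable_energyJump _ 0 n).neg)
      (measurable_countUpTo_ringTime 0 T)).div_const ε).ennreal_ofReal
  have hle : ∀ᵐ ω ∂noiseLaw (Fin d → ℤ),
      ({n | ε ≤ |energyJump (latticeGraph d) ω 0 n|}.encard : ℝ≥0∞) ≤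
        liminf (fun T : ℕ => ENNReal.ofReal
          ((∑ n ∈ Finset.range (countUpTo (ringTime ω 0) T),
            -energyJump (latticeGraph d) ω 0 n) / ε)) atTop := by
    filter_upwards [hG] with ω hω
    have hcount : Tendsto (fun T : ℕ => countUpTo (ringTime ω 0) (T : ℝ)) atTop atTop := by
      refine tendsto_atTop.2 fun m => ?_
      filter_upwards [eventually_ge_atTop ⌈ringTime ω 0 m⌉₊] with T hT
      exact ((lt_countUpTo (hω.strictMono 0) (hω.tendsto 0)).2 (Nat.ceil_le.1 hT)).le
    have hlim := (ENNReal.tendsto_nat_tsum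
      ({n | ε ≤ |energyJump (latticeGraph d) ω 0 n|}.indicator fun _ => 1)).comp hcount
    rw [← ENNReal.tsum_set_one, tsum_subtype _ fun _ => (1 : ℝ≥0∞), ← hlim.liminf_eq]
    refine liminf_le_liminf (Eventually.of_forall fun T => ?_)
    rw [Function.comp_apply, Finset.sum_div, ENNReal.ofReal_sum_of_nonneg fun n _ =>
      div_nonneg (neg_nonneg.2 (hω.energyJump_nonpos 0 n)) hε.le]
    -- All losses are nonnegative, and a flip losing at least `ε` contributes at least `1` after
    -- division by `ε`.
    refine Finset.sum_le_sum fun n _ => Set.indicator_apply_le' (fun hn => ?_) fun _ => zero_le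
    rw [Set.mem_ofPred_eq, abs_of_nonpos (hω.energyJump_nonpos 0 n)] at hn
    rw [ENNReal.one_le_ofReal]
    exact (one_le_div hε).2 hn
  calc _ ≤ _ := lintegral_mono_ae hle
    _ ≤ _ := lintegral_liminf_le hmeas
    _ ≤ ENNReal.ofReal (d / ε) :=
      liminf_le_of_le (by isBoundedDefault) fun b hb => by
        obtain ⟨T, hT⟩ := hb.exists
        exact hT.trans (lintegral_energyLoss_le T hε)

end Expectation

theorem mainTheorem7 (d : ℕ) (ε : ℝ) (hε : 0 < ε)
    {Ω : Type*} [MeasurableSpace Ω] (P : Measure Ω)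
    (X : Ω → (Fin d → ℤ) → SiteNoise) (hX : HasLaw X (noiseLaw (Fin d → ℤ)) P) :
    (∀ᵐ ω ∂P, ∃! η : ℝ≥0 → (Fin d → ℤ) → I, IsMedianTrajectory (latticeGraph d) (X ω) η) ∧
    ∀ η : Ω → ℝ≥0 → (Fin d → ℤ) → I,
      (∀ᵐ ω ∂P, IsMedianTrajectory (latticeGraph d) (X ω) (η ω)) →
        (∀ᵐ ω ∂P, (energyFlips (latticeGraph d) (X ω) (η ω) 0 ε).Finite) ∧
        AEMeasurable
          (fun ω => ((energyFlips (latticeGraph d) (X ω) (η ω) 0 ε).encard : ℝ≥0∞)) P ∧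
        ∫⁻ ω, ((energyFlips (latticeGraph d) (X ω) (η ω) 0 ε).encard : ℝ≥0∞) ∂P
          ≤ ENNReal.ofReal (d / ε) := by
  have hG : ∀ᵐ ω ∂P, IsGoodNoise (latticeGraph d) (X ω) :=
    ae_of_ae_map hX.aemeasurable (hX.map_eq ▸ ae_isGoodNoise_latticeGraph d)
  refine ⟨hG.mono fun ω hω => hω.existsUnique_trajectory, fun η hη => ?_⟩
  -- `η` carries no measurability assumption; almost surely its count equals a measurable functional
  -- of the noise alone.
  have heq : (fun ω => ((energyFlips (latticeGraph d) (X ω) (η ω) 0 ε).encard : ℝ≥0∞)) =ᵐ[P]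
      fun ω => ({n | ε ≤ |energyJump (latticeGraph d) (X ω) 0 n|}.encard : ℝ≥0∞) := by
    filter_upwards [hG, hη] with ω hω hηω
    rw [hω.energyFlips_eq hηω]
  have hmeas : AEMeasurable
      (fun ω => ((energyFlips (latticeGraph d) (X ω) (η ω) 0 ε).encard : ℝ≥0∞)) P :=
    ((measurable_encard_energyJump ε).comp_aemeasurable hX.aemeasurable).congr heq.symm
  have hle : ∫⁻ ω, ((energyFlips (latticeGraph d) (X ω) (η ω) 0 ε).encard : ℝ≥0∞) ∂P
      ≤ ENNReal.ofReal (d / ε) := by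
    rw [lintegral_congr_ae heq]
    refine le_trans (le_of_eq ?_) (lintegral_encard_energyJump_le hε)
    exact hX.lintegral_comp (measurable_encard_energyJump ε).aemeasurable
  refine ⟨?_, hmeas, hle⟩
  filter_upwards [ae_lt_top' hmeas (ne_top_of_le_ne_top ENNReal.ofReal_ne_top hle)] with ω hω
  rw [← Set.encard_lt_top_iff]
  exact ENat.toENNReal_lt_top.1 hω
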